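/- Write $(x;q)_n=\prod_{j=0}^{n-1}(1-xq^j)$ and $(x;q)_\infty=\prod_{j\ge 0}(1-xq^j)$, with the convention $1/(q;q)_m=0$ for integers $m<0$. Let $q$ be a complex number with $|q|<1$, fix a square root $q^{1/2}$ of $q$ (half-integral powers of $q$ are powers of it), and let $1\le i\le k$ be integers. In a product $(q;q)_{s_1-s_2}(q;q)_{s_2-s_3}\cdots(q;q)_{s_m}$ with $m=0$ indices, and in the corresponding multisum, the only term is the empty tuple, with value $1$ (every absent $s_j$ is $0$). **Theorem 5.1 (general form of Melzer's conjectures, odd case).** Let $a$ be a complex number with $aq^n\ne 1$ for all $n\ge 1$. Then the following three series converge absolutely and are equal: $$ \begin{aligned} &\sum_{n=0}^{\infty} (-1)^n a^{kn} q^{kn^2+(k-i+1/2)n}\,\frac{(-q^{1/2};q)_n\,(-aq^{n+3/2};q)_\infty}{(q;q)_n\,(aq^{n+1};q)_\infty}\left(1+aq^{n+1/2}-(1+q^{n+1/2})a^iq^{(i-1/2)(2n+1)}\right)\\ &=\sum_{s_1,\ldots,s_{k-1}\ge 0}\frac{a^{s_1+\cdots+s_{k-1}}\,(-q^{1/2};q)_{s_1}\,q^{s_1^2/2+s_2^2+\cdots+s_{k-1}^2+s_i+\cdots+s_{k-1}}}{(q;q)_{s_1-s_2}(q;q)_{s_2-s_3}\cdots(q;q)_{s_{k-1}}}\\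 &=\sum_{s_1,\ldots,s_{2k-2}\ge 0}\frac{a^{s_1+s_3+\cdots+s_{2k-3}}\,q^{(s_1^2+s_2^2+\cdots+s_{2k-2}^2)/2+s_{2i-1}+s_{2i+1}+\cdots+s_{2k-3}}}{(q;q)_{s_1-s_2}(q;q)_{s_2-s_3}\cdots(q;q)_{s_{2k-2}}}. \end{aligned} $$ Here $s_i+\cdots+s_{k-1}$ and $s_{2i-1}+s_{2i+1}+\cdots+s_{2k-3}$ are $0$ when $i=k$. In particular, for $a=1$ one obtains Melzer's fermionic form of the supersymmetric Virasoro character $\hat\chi^{(2,4k)}_{1,2i-1}$, that is, $$ \begin{aligned} &\sum_{s_1,\ldots,s_{2k-2}\ge 0}\frac{q^{(s_1^2+\cdots+s_{2k-2}^2)/2+s_{2i-1}+s_{2i+1}+\cdots+s_{2k-3}}}{(q;q)_{s_1-s_2}(q;q)_{s_2-s_3}\cdots(q;q)_{s_{2k-2}}}\\ &=\frac{(-q^{1/2};q)_\infty}{(q;q)_\infty}\left(1+\sum_{m=1}^\infty(-1)^m\left(q^{km^2-(k-i+1/2)m}+q^{km^2+(k-i+1/2)m}\right)\right)\\ &=\frac{(-q^{1/2};q)_\infty\,(q^{2k};q^{2k})_\infty\,(q^{i-1/2};q^{2k})_\infty\,(q^{2k-i+1/2};q^{2k})_\infty}{(q;q)_\infty}.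 \end{aligned} $$ Here the series in $m$ converges absolutely. -/

import Mathlib

/-- The finite `q`-shifted factorial `(x; q)_n = (1 - x) (1 - x q) ⋯ (1 - x q ^ (n - 1))`. -/
noncomputable def qPoch (x q : ℂ) (n : ℕ) : ℂ :=
  ∏ j ∈ Finset.range n, (1 - x * q ^ j)

/-- The infinite `q`-shifted factorial `(x; q)_∞ = ∏_{j ≥ 0} (1 - x q ^ j)`, for `‖q‖ < 1`. -/
noncomputable def qPochInf (x q : ℂ) : ℂ :=
  ∏' j : ℕ, (1 - x * q ^ j)

/-- The product that defines `(x; q)_∞` converges whenever `‖q‖ < 1`. -/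
theorem qPochInf_multipliable (x q : ℂ) (hq : ‖q‖ < 1) :
    Multipliable (fun j : ℕ => 1 - x * q ^ j) := by
  have h : Summable (fun j : ℕ => ‖-(x * q ^ j)‖) := by
    simpa [norm_mul, norm_pow] using
      (summable_geometric_of_lt_one (norm_nonneg q) hq).mul_left ‖x‖
  simpa [sub_eq_add_neg] using multipliable_one_add_of_summable h

/-- `1 / (q; q)_{m - n}`, with the usual convention that it is `0` when `m - n < 0`. -/
noncomputable def invQFact (q : ℂ) (m n : ℕ) : ℂ :=
  if n ≤ m then (qPoch q q (m - n))⁻¹ else 0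

/-- The entry `s_j` (indices start at `1`) of a tuple `(s_1, …, s_m)`, with `s_j = 0` for `j > m`
(and for `j = 0`, which is never used). -/
def entry {m : ℕ} (s : Fin m → ℕ) (j : ℕ) : ℕ :=
  if h : 0 < j ∧ j ≤ m then s ⟨j - 1, by omega⟩ else 0

/-- The denominator product
`1 / ((q; q)_{s_1 - s_2} (q; q)_{s_2 - s_3} ⋯ (q; q)_{s_{m-1} - s_m} (q; q)_{s_m})`. -/
noncomputable def chainWeight (q : ℂ) {m : ℕ} (s : Fin m → ℕ) : ℂ :=
  ∏ j ∈ Finset.Icc 1 m, invQFact q (entry s j) (entry s (j + 1))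

/-- The `n`-th term of the single sum, with `q = r ^ 2`, so that `r` is the chosen `q ^ (1/2)`. -/
noncomputable def singleTerm (k i : ℕ) (r a : ℂ) (n : ℕ) : ℂ :=
  (-1) ^ n * a ^ (k * n) * (r ^ 2) ^ (k * n ^ 2) * r ^ ((2 * (k - i) + 1) * n)
    * (qPoch (-r) (r ^ 2) n * qPochInf (-(a * r ^ (2 * n + 3))) (r ^ 2)
        / (qPoch (r ^ 2) (r ^ 2) n * qPochInf (a * (r ^ 2) ^ (n + 1)) (r ^ 2)))
    * (1 + a * r ^ (2 * n + 1)
        - (1 + r ^ (2 * n + 1)) * a ^ i * r ^ ((2 * i - 1) * (2 * n + 1)))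

/-- The term of the `(k - 1)`-fold multisum, with `q = r ^ 2`. -/
noncomputable def multiTermOne (k i : ℕ) (r a : ℂ) (s : Fin (k - 1) → ℕ) : ℂ :=
  a ^ (∑ j ∈ Finset.Icc 1 (k - 1), entry s j)
    * qPoch (-r) (r ^ 2) (entry s 1)
    * r ^ (entry s 1 ^ 2)
    * (r ^ 2) ^ (∑ j ∈ Finset.Icc 2 (k - 1), entry s j ^ 2
        + ∑ j ∈ Finset.Icc i (k - 1), entry s j)
    * chainWeight (r ^ 2) s

/-- The term of the `(2k - 2)`-fold multisum, with `q = r ^ 2`. The odd indices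
`1, 3, …, 2k - 3` are `2 j - 1` for `j = 1, …, k - 1`. -/
noncomputable def multiTermTwo (k i : ℕ) (r a : ℂ) (s : Fin (2 * k - 2) → ℕ) : ℂ :=
  a ^ (∑ j ∈ Finset.Icc 1 (k - 1), entry s (2 * j - 1))
    * r ^ (∑ j ∈ Finset.Icc 1 (2 * k - 2), entry s j ^ 2)
    * (r ^ 2) ^ (∑ j ∈ Finset.Icc i (k - 1), entry s (2 * j - 1))
    * chainWeight (r ^ 2) s

/-- The term with index `m = n + 1 ≥ 1` of the theta series, with `q = r ^ 2`:
`(-1)^m q^{k m^2} (q^{-(k - i + 1/2) m} + q^{(k - i + 1/2) m})`. For `1 ≤ i ≤ k` the difference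
of exponents is nonnegative, so the subtraction in `ℕ` does not truncate. -/
noncomputable def thetaTerm (k i : ℕ) (r : ℂ) (n : ℕ) : ℂ :=
  (-1) ^ (n + 1)
    * (r ^ (2 * k * (n + 1) ^ 2 - (2 * (k - i) + 1) * (n + 1))
      + r ^ (2 * k * (n + 1) ^ 2 + (2 * (k - i) + 1) * (n + 1)))

/-! Write `q = p ^ 2`. All three series are evaluations of one Bailey chain. The unit pair relative
to `a q` has `β = δ_{n,0}` (`isBaileyPair_unit`). Each application of the Bailey lemma with both
parameters at infinity (`IsBaileyPair.step`) multiplies `α_r` by `A^r q^{r²}` and adds one summation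
variable to `β`. For `i ≥ 2` one takes `k - i + 1` steps at `A = a q`, passes from `a q` to `a`
(`IsBaileyPair.of_mul_q`), and takes `i - 2` steps at `A = a`. For `i = 1` all `k - 1` steps stay at
`a q`.

The last variable `s_1` comes from the Bailey lemma with parameters `-p` and infinity, summed over
all `N` (`IsBaileyPair.tsum_eq`). Its `β` side is the `(k - 1)`-fold sum. Its `α` side is the single
sum, after a summation by parts when `i ≥ 2`, because the change of parameter makes `α_r` a
difference of two neighbouring terms.

In the `(2k - 2)`-fold sum the variables with even index carry only `p^{s²}`. The finite
`q`-binomial theorem sums them out, and the resulting products `(-p q^t; q)_{N-t}` telescope to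
`(-p; q)_{s_1}` (`nestedSum_interlacedWeight`). This gives the `(k - 1)`-fold sum.

At `a = 1` the infinite products in the single sum no longer depend on `n`. What remains is a theta
series, evaluated by the Jacobi triple product, itself a limit of the finite `q`-binomial theorem.
-/

open Filter Topology

/-! ### Shifted factorials: splitting, limits, uniform bounds. -/

theorem qPoch_zero (x q : ℂ) : qPoch x q 0 = 1 := by simp [qPoch]

theorem qPoch_succ (x q : ℂ) (n : ℕ) : qPoch x q (n + 1) = qPoch x q n * (1 - x * q ^ n) := by
  simp [qPoch, Finset.prod_range_succ]

theorem qPoch_add (x q : ℂ) (m n : ℕ) :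
    qPoch x q (m + n) = qPoch x q m * qPoch (x * q ^ m) q n := by
  simp [qPoch, Finset.prod_range_add, pow_add, mul_assoc]

theorem qPoch_succ' (x q : ℂ) (n : ℕ) :
    qPoch x q (n + 1) = (1 - x) * qPoch (x * q) q n := by
  rw [add_comm, qPoch_add]; simp [qPoch]

theorem qPoch_zero_left (q : ℂ) (n : ℕ) : qPoch 0 q n = 1 := by simp [qPoch]

theorem qPoch_ne_zero {x q : ℂ} (h : ∀ j : ℕ, x * q ^ j ≠ 1) (n : ℕ) : qPoch x q n ≠ 0 :=
  Finset.prod_ne_zero_iff.2 fun j _ => sub_ne_zero.2 (h j).symm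

theorem pow_ne_one_of_norm_lt_one {q : ℂ} (hq : ‖q‖ < 1) {n : ℕ} (hn : n ≠ 0) : q ^ n ≠ 1 := by
  intro h
  have h1 : ‖q‖ ^ n = 1 := by rw [← norm_pow, h, norm_one]
  exact (pow_lt_one₀ (norm_nonneg q) hq hn).ne h1

theorem mul_pow_ne_one_of_norm_lt_one {q : ℂ} (hq : ‖q‖ < 1) (j : ℕ) : q * q ^ j ≠ 1 := by
  rw [← pow_succ']; exact pow_ne_one_of_norm_lt_one hq j.succ_ne_zero

theorem qPoch_self_ne_zero {q : ℂ} (hq : ‖q‖ < 1) (n : ℕ) : qPoch q q n ≠ 0 :=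
  qPoch_ne_zero (mul_pow_ne_one_of_norm_lt_one hq) n

theorem qPoch_mul_qPochInf (x : ℂ) {q : ℂ} (hq : ‖q‖ < 1) (n : ℕ) :
    qPoch x q n * qPochInf (x * q ^ n) q = qPochInf x q := by
  have h := Multipliable.prod_mul_tprod_nat_mul' (f := fun j : ℕ => 1 - x * q ^ j) (k := n)
    (by simpa [pow_add, mul_assoc, mul_comm, mul_left_comm] using
      qPochInf_multipliable (x * q ^ n) q hq)
  unfold qPochInf
  rw [← h, qPoch]
  congr 2
  ext j
  ring

theorem tendsto_qPoch (x : ℂ) {q : ℂ} (hq : ‖q‖ < 1) :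
    Tendsto (qPoch x q) atTop (𝓝 (qPochInf x q)) :=
  (qPochInf_multipliable x q hq).hasProd.tendsto_prod_nat

theorem qPochInf_ne_zero {x q : ℂ} (hq : ‖q‖ < 1) (h : ∀ j : ℕ, x * q ^ j ≠ 1) :
    qPochInf x q ≠ 0 := by
  have h1 : Summable (fun j : ℕ => ‖-(x * q ^ j)‖) := by
    simpa [norm_mul, norm_pow] using
      (summable_geometric_of_lt_one (norm_nonneg q) hq).mul_left ‖x‖
  have := tprod_one_add_ne_zero_of_summable (f := fun j : ℕ => -(x * q ^ j))
    (fun j => by rw [← sub_eq_add_neg]; exact sub_ne_zero.2 (h j).symm) h1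
  simpa [qPochInf, sub_eq_add_neg] using this

theorem qPochInf_zero_left (q : ℂ) : qPochInf 0 q = 1 := by simp [qPochInf]

/-- A bound for `(x; q)_n` that is uniform in `n`. -/
theorem norm_qPoch_le (x : ℂ) {q : ℂ} (hq : ‖q‖ < 1) (n : ℕ) :
    ‖qPoch x q n‖ ≤ Real.exp (‖x‖ * (1 - ‖q‖)⁻¹) := by
  have hs := summable_geometric_of_lt_one (norm_nonneg q) hq
  calc ‖qPoch x q n‖ = ∏ j ∈ Finset.range n, ‖1 - x * q ^ j‖ := by rw [qPoch, norm_prod]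
    _ ≤ ∏ j ∈ Finset.range n, Real.exp (‖x‖ * ‖q‖ ^ j) := by
        refine Finset.prod_le_prod (fun _ _ => norm_nonneg _) fun j _ => ?_
        refine (norm_sub_le _ _).trans ?_
        rw [norm_one, norm_mul, norm_pow, add_comm]
        exact Real.add_one_le_exp _
    _ = Real.exp (‖x‖ * ∑ j ∈ Finset.range n, ‖q‖ ^ j) := by
        rw [← Real.exp_sum, Finset.mul_sum]
    _ ≤ _ := by
        rw [← tsum_geometric_of_lt_one (norm_nonneg q) hq]
        refine Real.exp_le_exp.2 (mul_le_mul_of_nonneg_left ?_ (norm_nonneg x))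
        exact hs.sum_le_tsum _ fun j _ => by positivity

theorem norm_qPoch_mul_pow_le (x : ℂ) {q : ℂ} (hq : ‖q‖ < 1) (m n : ℕ) :
    ‖qPoch (x * q ^ m) q n‖ ≤ Real.exp (‖x‖ * (1 - ‖q‖)⁻¹) := by
  refine (norm_qPoch_le _ hq n).trans (Real.exp_le_exp.2 ?_)
  have : 0 < 1 - ‖q‖ := by linarith
  refine mul_le_mul_of_nonneg_right ?_ (by positivity)
  rw [norm_mul, norm_pow]
  exact mul_le_of_le_one_right (norm_nonneg x) (pow_le_one₀ (norm_nonneg q) hq.le)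

theorem norm_qPochInf_mul_pow_le (x : ℂ) {q : ℂ} (hq : ‖q‖ < 1) (m : ℕ) :
    ‖qPochInf (x * q ^ m) q‖ ≤ Real.exp (‖x‖ * (1 - ‖q‖)⁻¹) :=
  le_of_tendsto (tendsto_qPoch (x * q ^ m) hq).norm
    (Eventually.of_forall fun n => norm_qPoch_mul_pow_le x hq m n)

/-- The inverses converge, since the limit `(x; q)_∞` is nonzero, and a convergent sequence is
bounded. -/
theorem exists_norm_inv_qPoch_le {x q : ℂ} (hq : ‖q‖ < 1) (h : ∀ j : ℕ, x * q ^ j ≠ 1) :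
    ∃ C : ℝ, 0 ≤ C ∧ ∀ n, ‖(qPoch x q n)⁻¹‖ ≤ C := by
  have ht := (tendsto_qPoch x hq).inv₀ (qPochInf_ne_zero hq h)
  obtain ⟨C, hC⟩ := ht.norm.bddAbove_range
  exact ⟨C, (norm_nonneg _).trans (hC ⟨0, rfl⟩), fun n => hC ⟨n, rfl⟩⟩

/-! ### Convergence: quadratic exponents beat geometric growth. -/

theorem summable_pow_mul_pow_choose_two {L ρ : ℝ} (hL : 0 ≤ L) (hρ : 0 ≤ ρ) (hρ1 : ρ < 1) :
    Summable fun n : ℕ => L ^ n * ρ ^ n.choose 2 := by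
  have ht : Tendsto (fun n : ℕ => L * ρ ^ n) atTop (𝓝 0) := by
    simpa using (tendsto_pow_atTop_nhds_zero_of_lt_one hρ hρ1).const_mul L
  refine summable_of_ratio_norm_eventually_le (r := 1 / 2) (by norm_num) ?_
  filter_upwards [ht.eventually (ge_mem_nhds (show (0 : ℝ) < 1 / 2 by norm_num))] with n hn
  have : L ^ (n + 1) * ρ ^ (n + 1).choose 2 = (L * ρ ^ n) * (L ^ n * ρ ^ n.choose 2) := by
    rw [Nat.choose_succ_succ' n 1, Nat.choose_one_right]; ring
  rw [this, norm_mul, Real.norm_of_nonneg (by positivity : 0 ≤ L * ρ ^ n)]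
  exact mul_le_mul_of_nonneg_right hn (norm_nonneg _)

/-- Sequences of at most geometric growth. -/
def GeomBounded (f : ℕ → ℂ) : Prop :=
  ∃ C L : ℝ, 0 ≤ C ∧ 0 ≤ L ∧ ∀ n, ‖f n‖ ≤ C * L ^ n

namespace GeomBounded

theorem of_bounded {f : ℕ → ℂ} {C : ℝ} (h : ∀ n, ‖f n‖ ≤ C) : GeomBounded f :=
  ⟨C, 1, (norm_nonneg _).trans (h 0), zero_le_one, by simpa using h⟩

theorem pow (x : ℂ) : GeomBounded fun n => x ^ n :=
  ⟨1, ‖x‖, zero_le_one, norm_nonneg x, fun n => by simp⟩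

theorem pow_of_norm_le_one {x : ℂ} (hx : ‖x‖ ≤ 1) (e : ℕ → ℕ) : GeomBounded fun n => x ^ e n :=
  of_bounded (C := 1) fun n => by rw [norm_pow]; exact pow_le_one₀ (norm_nonneg x) hx

theorem mul {f g : ℕ → ℂ} (hf : GeomBounded f) (hg : GeomBounded g) :
    GeomBounded fun n => f n * g n := by
  obtain ⟨C, L, hC, hL, h⟩ := hf
  obtain ⟨D, M, hD, hM, h'⟩ := hg
  refine ⟨C * D, L * M, by positivity, by positivity, fun n => ?_⟩
  rw [norm_mul, mul_pow, mul_mul_mul_comm]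
  exact mul_le_mul (h n) (h' n) (norm_nonneg _) (by positivity)

theorem sub {f g : ℕ → ℂ} (hf : GeomBounded f) (hg : GeomBounded g) :
    GeomBounded fun n => f n - g n := by
  obtain ⟨C, L, hC, hL, h⟩ := hf
  obtain ⟨D, M, hD, hM, h'⟩ := hg
  refine ⟨C + D, L + M, by positivity, by positivity, fun n => ?_⟩
  refine (norm_sub_le _ _).trans ?_
  rw [add_mul]
  refine add_le_add ((h n).trans ?_) ((h' n).trans ?_)
  · exact mul_le_mul_of_nonneg_left (pow_le_pow_left₀ hL (by linarith) n) hC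
  · exact mul_le_mul_of_nonneg_left (pow_le_pow_left₀ hM (by linarith) n) hD

theorem pow_const {f : ℕ → ℂ} (hf : GeomBounded f) (m : ℕ) : GeomBounded fun n => f n ^ m := by
  induction m with
  | zero => exact of_bounded (C := 1) (by simp)
  | succ m ih => simpa only [pow_succ] using ih.mul hf

/-- Extension of the index range by one value at `0`. -/
theorem of_comp_succ {f : ℕ → ℂ} (hf : GeomBounded fun n => f (n + 1)) : GeomBounded f := by
  obtain ⟨C, L, hC, hL, h⟩ := hf
  refine ⟨C + ‖f 0‖, L + 1, by positivity, by positivity, fun n => ?_⟩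
  cases n with
  | zero => simpa using hC
  | succ n =>
    refine (h n).trans (mul_le_mul (by linarith [norm_nonneg (f 0)]) ?_ (by positivity)
      (by positivity))
    exact (pow_le_pow_left₀ hL (by linarith) n).trans
      (pow_le_pow_right₀ (by linarith) n.le_succ)

theorem summable_norm_pow_choose_mul {f : ℕ → ℂ} (hf : GeomBounded f) {q : ℂ} (hq : ‖q‖ < 1) :
    Summable fun n : ℕ => ‖q ^ n.choose 2 * f n‖ := by
  obtain ⟨C, L, hC, hL, h⟩ := hf
  refine Summable.of_nonneg_of_le (fun _ => norm_nonneg _) (fun n => ?_)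
    ((summable_pow_mul_pow_choose_two hL (norm_nonneg q) hq).mul_left C)
  rw [norm_mul, norm_pow, mul_comm, ← mul_assoc]
  exact mul_le_mul_of_nonneg_right (h n) (by positivity)

theorem summable_norm_pow_sq_mul {f : ℕ → ℂ} (hf : GeomBounded f) {q : ℂ} (hq : ‖q‖ < 1) :
    Summable fun n : ℕ => ‖q ^ n ^ 2 * f n‖ := by
  refine Summable.of_nonneg_of_le (fun _ => norm_nonneg _) (fun n => ?_)
    (hf.summable_norm_pow_choose_mul hq)
  rw [norm_mul, norm_mul, norm_pow, norm_pow]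
  refine mul_le_mul_of_nonneg_right (pow_le_pow_of_le_one (norm_nonneg q) hq.le ?_)
    (norm_nonneg _)
  exact Nat.choose_le_pow n 2

end GeomBounded

theorem geomBounded_qPoch (x : ℂ) {q : ℂ} (hq : ‖q‖ < 1) : GeomBounded (qPoch x q) :=
  GeomBounded.of_bounded (norm_qPoch_le x hq)

theorem geomBounded_inv_qPoch {x q : ℂ} (hq : ‖q‖ < 1) (h : ∀ j : ℕ, x * q ^ j ≠ 1) :
    GeomBounded fun n => (qPoch x q n)⁻¹ := by
  obtain ⟨C, -, hC⟩ := exists_norm_inv_qPoch_le hq h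
  exact GeomBounded.of_bounded hC

/-! ### Gaussian binomials and the `q`-Chu–Vandermonde sum. -/

/-- The Gaussian binomial coefficient, by Pascal's rule. -/
def gaussBinom (q : ℂ) : ℕ → ℕ → ℂ
  | _, 0 => 1
  | 0, _ + 1 => 0
  | n + 1, k + 1 => q ^ (k + 1) * gaussBinom q n (k + 1) + gaussBinom q n k

theorem gaussBinom_zero_right (q : ℂ) (n : ℕ) : gaussBinom q n 0 = 1 := by
  cases n <;> rfl

theorem gaussBinom_eq_zero_of_lt (q : ℂ) {n k : ℕ} (h : n < k) : gaussBinom q n k = 0 := by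
  induction n generalizing k with
  | zero => obtain ⟨k, rfl⟩ := Nat.exists_eq_succ_of_ne_zero h.ne'; rfl
  | succ n ih =>
    obtain ⟨k, rfl⟩ := Nat.exists_eq_succ_of_ne_zero (by omega : k ≠ 0)
    simp [gaussBinom, ih (show n < k + 1 by omega), ih (show n < k by omega)]

theorem gaussBinom_self (q : ℂ) (n : ℕ) : gaussBinom q n n = 1 := by
  induction n with
  | zero => rfl
  | succ n ih => simp [gaussBinom, ih, gaussBinom_eq_zero_of_lt q (Nat.lt_succ_self n)]

theorem gaussBinom_add_mul (q : ℂ) (m k : ℕ) :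
    gaussBinom q (m + k) k * (qPoch q q k * qPoch q q m) = qPoch q q (m + k) := by
  induction k generalizing m with
  | zero => simp [gaussBinom_zero_right, qPoch_zero]
  | succ k ihk =>
    induction m with
    | zero => simp [gaussBinom_self, qPoch_zero]
    | succ m ihm =>
      have h1 := ihk (m + 1)
      have e1 : m + 1 + k = m + (k + 1) := by omega
      rw [e1] at h1
      rw [show m + 1 + (k + 1) = (m + (k + 1)) + 1 by omega, gaussBinom,
        qPoch_succ q q (m + (k + 1))]
      rw [qPoch_succ q q k] at ihm ⊢
      rw [qPoch_succ q q m] at h1 ⊢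
      linear_combination q ^ (k + 1) * (1 - q * q ^ m) * ihm + (1 - q * q ^ k) * h1

theorem gaussBinom_eq_div {q : ℂ} (hq : ‖q‖ < 1) {n k : ℕ} (h : k ≤ n) :
    gaussBinom q n k = qPoch q q n * ((qPoch q q k)⁻¹ * (qPoch q q (n - k))⁻¹) := by
  obtain ⟨m, rfl⟩ := Nat.exists_eq_add_of_le' h
  rw [← gaussBinom_add_mul, Nat.add_sub_cancel]
  have := qPoch_self_ne_zero hq k
  have := qPoch_self_ne_zero hq m
  field_simp

/-- Pascal's rule transferred to the summand, which lets sums against Gaussian binomials be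
evaluated by induction on `M`. -/
theorem sum_gaussBinom_succ_mul (q : ℂ) (M : ℕ) (T : ℕ → ℂ) :
    ∑ m ∈ Finset.range (M + 2), gaussBinom q (M + 1) m * T m =
      ∑ m ∈ Finset.range (M + 1), gaussBinom q M m * (q ^ m * T m + T (m + 1)) := by
  have h : ∑ m ∈ Finset.range (M + 1), gaussBinom q M m * (q ^ m * T m) =
      ∑ m ∈ Finset.range (M + 2), gaussBinom q M m * (q ^ m * T m) := by
    rw [Finset.sum_range_succ _ (M + 1), gaussBinom_eq_zero_of_lt q (Nat.lt_succ_self M)]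
    simp
  simp only [mul_add, Finset.sum_add_distrib]
  rw [h, Finset.sum_range_succ', Finset.sum_range_succ' _ (M + 1)]
  simp only [gaussBinom, gaussBinom_zero_right, add_mul, Finset.sum_add_distrib, pow_zero, one_mul]
  rw [add_right_comm]
  congr 2
  exact Finset.sum_congr rfl fun m _ => by ring

/-- The homogeneous form of the `q`-Chu–Vandermonde sum. -/
theorem sum_gaussBinom_vandermonde (q z w : ℂ) (M : ℕ) :
    ∑ m ∈ Finset.range (M + 1), gaussBinom q M m *
      (q ^ m.choose 2 * (∏ j ∈ Finset.range m, (z + w * q ^ j)) * qPoch (w * q ^ m) q (M - m)) =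
      qPoch (-z) q M := by
  induction M generalizing z w with
  | zero => simp [gaussBinom, qPoch_zero]
  | succ M ih =>
    -- The two terms produced by Pascal's rule differ only in the factors `1 - w q^m` and `z + w
    -- q^m`. Their sum `1 + z` is free of `m`, and the rest is the sum for `(q z, q w)`.
    rw [sum_gaussBinom_succ_mul, qPoch_succ', show -z * q = -(q * z) by ring, ← ih (q * z) (q * w),
      Finset.mul_sum]
    refine Finset.sum_congr rfl fun m hm => ?_
    have hm : m ≤ M := Nat.lt_succ_iff.1 (Finset.mem_range.1 hm)
    rw [show M + 1 - m = (M - m) + 1 by omega, show M + 1 - (m + 1) = M - m by omega,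
      qPoch_succ' (w * q ^ m), Nat.choose_succ_succ' m 1, Nat.choose_one_right,
      Finset.prod_range_succ, show w * q ^ m * q = q * w * q ^ m by ring,
      show w * q ^ (m + 1) = q * w * q ^ m by ring]
    have : ∏ j ∈ Finset.range m, (q * z + q * w * q ^ j) =
        q ^ m * ∏ j ∈ Finset.range m, (z + w * q ^ j) := by
      rw [Finset.prod_congr rfl (fun j _ => (by ring :
        q * z + q * w * q ^ j = q * (z + w * q ^ j))), Finset.prod_mul_distrib]
      simp
    rw [this]
    ring

/-- The finite `q`-binomial theorem. -/
theorem sum_gaussBinom_mul_pow (q z : ℂ) (M : ℕ) :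
    ∑ m ∈ Finset.range (M + 1), gaussBinom q M m * (q ^ m.choose 2 * z ^ m) = qPoch (-z) q M := by
  simpa [qPoch_zero_left] using sum_gaussBinom_vandermonde q z 0 M

theorem choose_two_add_choose_two_add_self (m : ℕ) : m.choose 2 + m.choose 2 + m = m ^ 2 := by
  induction m with
  | zero => rfl
  | succ m ih => rw [Nat.choose_succ_succ' m 1, Nat.choose_one_right]; linarith

theorem prod_range_mul_pow (z q : ℂ) (m : ℕ) :
    ∏ j ∈ Finset.range m, z * q ^ j = z ^ m * q ^ m.choose 2 := by
  induction m with
  | zero => simp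
  | succ m ih =>
    rw [Finset.prod_range_succ, ih, Nat.choose_succ_succ' m 1, Nat.choose_one_right]; ring

/-- The limiting `q`-Chu–Vandermonde sum behind the Bailey lemma. -/
theorem sum_pow_sq_div_qPoch {q c : ℂ} (hq : ‖q‖ < 1) (hc : ∀ j : ℕ, c * q * q ^ j ≠ 1) (M : ℕ) :
    ∑ m ∈ Finset.range (M + 1), c ^ m * q ^ m ^ 2 *
      ((qPoch q q (M - m))⁻¹ * (qPoch q q m)⁻¹ * (qPoch (c * q) q m)⁻¹) =
      (qPoch q q M)⁻¹ * (qPoch (c * q) q M)⁻¹ := by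
  have h := sum_gaussBinom_vandermonde q 0 (c * q) M
  have hM := qPoch_self_ne_zero hq M
  have hM' := qPoch_ne_zero hc M
  rw [neg_zero, qPoch_zero_left] at h
  rw [← mul_one ((qPoch q q M)⁻¹ * _), ← h, Finset.mul_sum]
  refine Finset.sum_congr rfl fun m hm => ?_
  have hm : m ≤ M := Nat.lt_succ_iff.1 (Finset.mem_range.1 hm)
  have h1 : qPoch (c * q) q M = qPoch (c * q) q m * qPoch (c * q * q ^ m) q (M - m) := by
    rw [← qPoch_add, Nat.add_sub_cancel' hm]
  have h2 := qPoch_ne_zero hc m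
  have h3 : qPoch (c * q * q ^ m) q (M - m) ≠ 0 := fun h => hM' (by rw [h1, h, mul_zero])
  have h4 : ∏ j ∈ Finset.range m, (0 + c * q * q ^ j) = c ^ m * (q ^ m * q ^ m.choose 2) := by
    simp only [zero_add]; rw [prod_range_mul_pow]; ring
  rw [gaussBinom_eq_div hq hm, h1, h4, ← choose_two_add_choose_two_add_self m, pow_add, pow_add]
  generalize qPoch (c * q * q ^ m) q (M - m) = y at h3
  field_simp

/-- Uniformity in both arguments provides the dominating series when `M` tends to infinity in the
finite identities. -/
theorem exists_norm_gaussBinom_le {q : ℂ} (hq : ‖q‖ < 1) :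
    ∃ B : ℝ, 0 ≤ B ∧ ∀ n k, ‖gaussBinom q n k‖ ≤ B := by
  obtain ⟨C, hC0, hC⟩ := exists_norm_inv_qPoch_le hq (mul_pow_ne_one_of_norm_lt_one hq)
  refine ⟨Real.exp (‖q‖ * (1 - ‖q‖)⁻¹) * (C * C), by positivity, fun n k => ?_⟩
  rcases le_or_gt k n with h | h
  · rw [gaussBinom_eq_div hq h, norm_mul, norm_mul]
    exact mul_le_mul (norm_qPoch_le q hq n)
      (mul_le_mul (hC k) (hC _) (norm_nonneg _) hC0) (by positivity) (by positivity)
  · rw [gaussBinom_eq_zero_of_lt q h, norm_zero]; positivity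

theorem tendsto_gaussBinom {q : ℂ} (hq : ‖q‖ < 1) (k : ℕ) :
    Tendsto (fun n => gaussBinom q n k) atTop (𝓝 (qPoch q q k)⁻¹) := by
  have h0 := qPochInf_ne_zero hq (mul_pow_ne_one_of_norm_lt_one hq)
  have h1 := tendsto_qPoch q hq
  have h2 := (h1.comp (tendsto_sub_atTop_nat k)).inv₀ h0
  have h3 := h1.mul (h2.const_mul (qPoch q q k)⁻¹)
  rw [mul_left_comm, mul_inv_cancel₀ h0, mul_one] at h3
  refine h3.congr' ?_
  filter_upwards [eventually_ge_atTop k] with n hn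
  rw [gaussBinom_eq_div hq hn]; rfl

theorem tendsto_gaussBinom_two_mul {q : ℂ} (hq : ‖q‖ < 1) (l : ℕ) :
    Tendsto (fun M => gaussBinom q (2 * M) (M + l)) atTop (𝓝 (qPochInf q q)⁻¹) := by
  have h0 := qPochInf_ne_zero hq (mul_pow_ne_one_of_norm_lt_one hq)
  have h1 := tendsto_qPoch q hq
  have h2 := h1.comp (tendsto_id.const_mul_atTop' (show 0 < 2 by norm_num) :
    Tendsto (fun M : ℕ => 2 * M) atTop atTop)
  have h3 := (h1.comp (tendsto_add_atTop_nat l)).inv₀ h0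
  have h4 := (h1.comp (tendsto_sub_atTop_nat l)).inv₀ h0
  have h5 := h2.mul (h3.mul h4)
  rw [mul_inv_cancel_left₀ h0] at h5
  refine h5.congr' ?_
  filter_upwards [eventually_ge_atTop l] with M hM
  rw [gaussBinom_eq_div hq (by omega), show 2 * M - (M + l) = M - l by omega]; rfl

theorem norm_prod_add_mul_pow_le (z w : ℂ) {q : ℂ} (hq : ‖q‖ < 1) (m : ℕ) :
    ‖∏ j ∈ Finset.range m, (z + w * q ^ j)‖ ≤ (‖z‖ + ‖w‖) ^ m := by
  rw [norm_prod]
  refine (Finset.prod_le_prod (fun _ _ => norm_nonneg _) (g := fun _ => ‖z‖ + ‖w‖)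
    fun j _ => ?_).trans_eq (by simp)
  refine (norm_add_le _ _).trans (add_le_add_right ?_ _)
  rw [norm_mul, norm_pow]
  exact mul_le_of_le_one_right (norm_nonneg w) (pow_le_one₀ (norm_nonneg q) hq.le)

/-- The homogeneous form of the `₁φ₁` summation. -/
theorem tsum_vandermonde {q : ℂ} (hq : ‖q‖ < 1) (z w : ℂ) :
    ∑' m : ℕ, (qPoch q q m)⁻¹ * (q ^ m.choose 2 * (∏ j ∈ Finset.range m, (z + w * q ^ j)) *
      qPochInf (w * q ^ m) q) = qPochInf (-z) q := by
  obtain ⟨B, hB0, hB⟩ := exists_norm_gaussBinom_le hq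
  set E := Real.exp (‖w‖ * (1 - ‖q‖)⁻¹)
  have hs := (summable_pow_mul_pow_choose_two (L := ‖z‖ + ‖w‖) (by positivity)
    (norm_nonneg q) hq).mul_left (B * E)
  have key := tendsto_tsum_of_dominated_convergence (𝓕 := atTop)
    (f := fun M m => gaussBinom q M m * (q ^ m.choose 2 *
      (∏ j ∈ Finset.range m, (z + w * q ^ j)) * qPoch (w * q ^ m) q (M - m))) hs
    (fun m => (tendsto_gaussBinom hq m).mul
      (((tendsto_qPoch (w * q ^ m) hq).comp (tendsto_sub_atTop_nat m)).const_mul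
        (q ^ m.choose 2 * ∏ j ∈ Finset.range m, (z + w * q ^ j))))
    (Eventually.of_forall fun M m => by
      rw [norm_mul, norm_mul, norm_mul, norm_pow]
      calc _ ≤ B * (‖q‖ ^ m.choose 2 * (‖z‖ + ‖w‖) ^ m * E) := by
            gcongr
            · exact hB M m
            · exact norm_prod_add_mul_pow_le z w hq m
            · exact norm_qPoch_mul_pow_le w hq m _
        _ = _ := by ring)
  refine tendsto_nhds_unique key ((tendsto_qPoch (-z) hq).congr fun M => ?_)
  rw [← sum_gaussBinom_vandermonde q z w M, tsum_eq_sum]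
  intro m hm
  rw [gaussBinom_eq_zero_of_lt q (by simpa using hm), zero_mul]

/-! ### The Jacobi triple product. -/

theorem add_choose_two (a b : ℕ) : (a + b).choose 2 = a.choose 2 + b.choose 2 + a * b := by
  induction b with
  | zero => simp
  | succ b ih =>
    rw [← add_assoc, Nat.choose_succ_succ' _ 1, Nat.choose_succ_succ' b 1, Nat.choose_one_right,
      Nat.choose_one_right, ih]
    ring

theorem gaussBinom_symm {q : ℂ} (hq : ‖q‖ < 1) {n k : ℕ} (h : k ≤ n) :
    gaussBinom q n (n - k) = gaussBinom q n k := by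
  rw [gaussBinom_eq_div hq h, gaussBinom_eq_div hq (Nat.sub_le n k), Nat.sub_sub_self h,
    mul_comm (qPoch q q k)⁻¹]

/-- The finite Jacobi triple product. -/
theorem finite_jacobi_triple_product {q X Y : ℂ} (hq : ‖q‖ < 1) (hq0 : q ≠ 0) (hXY : X * Y = q)
    (M : ℕ) :
    gaussBinom q (2 * M) M + ∑ l ∈ Finset.range M, gaussBinom q (2 * M) (M + (l + 1)) *
      (q ^ (l + 1).choose 2 * ((-X) ^ (l + 1) + (-Y) ^ (l + 1))) = qPoch X q M * qPoch Y q M := by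
  have hX : X ≠ 0 := fun h => hq0 (by rw [← hXY, h, zero_mul])
  have hqM : q ^ M ≠ 0 := pow_ne_zero M hq0
  -- The `q`-binomial theorem of order `2M` is used at `-X / q^M`, so that its middle term has index
  -- `M`. `K` is what that term leaves once the factor `(q^M)^{2M}` has cleared denominators.
  set K := q ^ (M ^ 2 + M.choose 2) * (-X) ^ M with hK
  have hK0 : K ≠ 0 := mul_ne_zero (pow_ne_zero _ hq0) (pow_ne_zero _ (neg_ne_zero.2 hX))
  have hprod : (q ^ M) ^ (2 * M) * qPoch (X / q ^ M) q (2 * M) =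
      K * (qPoch X q M * qPoch Y q M) := by
    rw [two_mul, qPoch_add, div_mul_cancel₀ X hqM, pow_add]
    -- The lower half of the product, read backwards: `1 - X q^{-j} = -X q^{-j} (1 - Y q^{j-1})`,
    -- because `X Y = q`.
    have : (q ^ M) ^ M * qPoch (X / q ^ M) q M = (-X) ^ M * q ^ M.choose 2 * qPoch Y q M := by
      have h1 : (q ^ M) ^ M * qPoch (X / q ^ M) q M =
          ∏ j ∈ Finset.range M, (q ^ M - X * q ^ j) := by
        rw [qPoch, ← Finset.card_range M, ← Finset.prod_const, Finset.card_range,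
          ← Finset.prod_mul_distrib]
        exact Finset.prod_congr rfl fun j _ => by field_simp
      rw [h1, ← prod_range_mul_pow, ← Finset.prod_range_reflect _ M, qPoch]
      rw [← Finset.prod_range_reflect (fun j => -X * q ^ j) M, ← Finset.prod_mul_distrib]
      refine Finset.prod_congr rfl fun j hj => ?_
      have hj := Finset.mem_range.1 hj
      obtain ⟨d, rfl⟩ : ∃ d, M = d + j + 1 := ⟨M - j - 1, by omega⟩
      rw [show d + j + 1 - 1 - j = d by omega]
      linear_combination (-q ^ (d + j)) * hXY
    linear_combination (q ^ M) ^ M * qPoch X q M * this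
  have hsum := sum_gaussBinom_mul_pow q (-(X / q ^ M)) (2 * M)
  rw [neg_neg] at hsum
  apply mul_left_cancel₀ hK0
  rw [← hprod, ← hsum, show 2 * M + 1 = M + (M + 1) by omega,
    Finset.sum_range_add, Finset.sum_range_succ' _ M, ← Finset.sum_range_reflect
      (fun m => gaussBinom q (2 * M) m * (q ^ m.choose 2 * (-(X / q ^ M)) ^ m)) M]
  have hup : ∀ j ≤ M, (q ^ M) ^ (2 * M) * (q ^ (M + j).choose 2 * (-(X / q ^ M)) ^ (M + j)) =
      K * (q ^ j.choose 2 * (-X) ^ j) := by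
    intro j hj
    have : (q ^ M) ^ (2 * M) * (-(X / q ^ M)) ^ (M + j) = (q ^ M) ^ (M - j) * (-X) ^ (M + j) := by
      rw [show 2 * M = (M - j) + (M + j) by omega, pow_add, mul_assoc, ← mul_pow]
      congr 2; field_simp
    obtain ⟨d, rfl⟩ := Nat.exists_eq_add_of_le hj
    rw [mul_left_comm, this, Nat.add_sub_cancel_left, add_choose_two, hK]
    ring
  have hdown : ∀ j ≤ M, (q ^ M) ^ (2 * M) * (q ^ (M - j).choose 2 * (-(X / q ^ M)) ^ (M - j)) =
      K * (q ^ j.choose 2 * (-Y) ^ j) := by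
    intro j hj
    have : (q ^ M) ^ (2 * M) * (-(X / q ^ M)) ^ (M - j) = (q ^ M) ^ (M + j) * (-X) ^ (M - j) := by
      rw [show 2 * M = (M + j) + (M - j) by omega, pow_add, mul_assoc, ← mul_pow]
      congr 2; field_simp
    obtain ⟨d, rfl⟩ := Nat.exists_eq_add_of_le' hj
    rw [mul_left_comm, this, Nat.add_sub_cancel, hK, pow_add (-X)]
    have h2 : (-X) ^ j * (-Y) ^ j = q ^ j := by rw [← mul_pow, neg_mul_neg, hXY]
    have h3 : q ^ ((d + j) ^ 2 + (d + j).choose 2) * q ^ j.choose 2 * q ^ j =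
        q ^ d.choose 2 * (q ^ (d + j)) ^ (d + j + j) := by
      rw [← pow_mul, ← pow_add, ← pow_add, ← pow_add]
      congr 1
      rw [add_choose_two]
      linarith [choose_two_add_choose_two_add_self j]
    linear_combination (-(-X) ^ d) * h3 -
      (-X) ^ d * q ^ ((d + j) ^ 2 + (d + j).choose 2) * q ^ j.choose 2 * h2
  have e0 := hup 0 (Nat.zero_le M)
  rw [← add_assoc, ← Finset.sum_add_distrib, mul_add, mul_add, Finset.mul_sum, Finset.mul_sum,
    add_comm]
  simp only [add_zero, Nat.choose_zero_succ, pow_zero, mul_one] at e0 ⊢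
  congr 1
  · refine Finset.sum_congr rfl fun l hl => ?_
    have hl := Finset.mem_range.1 hl
    have e1 := hup (l + 1) hl
    have e2 := hdown (l + 1) hl
    have e3 := gaussBinom_symm hq (show M + (l + 1) ≤ 2 * M by omega)
    rw [show 2 * M - (M + (l + 1)) = M - (l + 1) by omega] at e3
    rw [show M - 1 - l = M - (l + 1) by omega, e3]
    linear_combination (-gaussBinom q (2 * M) (M + (l + 1))) * (e1 + e2)
  · linear_combination (-gaussBinom q (2 * M) M) * e0

theorem summable_theta {q : ℂ} (hq : ‖q‖ < 1) (X Y : ℂ) :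
    Summable fun l : ℕ => ‖q ^ (l + 1).choose 2 * ((-X) ^ (l + 1) + (-Y) ^ (l + 1))‖ := by
  have h : GeomBounded fun n => (-X) ^ n - (-1) * (-Y) ^ n :=
    (GeomBounded.pow _).sub
      ((GeomBounded.of_bounded (f := fun _ => -1) (C := 1) (by simp)).mul (.pow _))
  have := (summable_nat_add_iff 1).2 (h.summable_norm_pow_choose_mul hq)
  simpa using this

/-- The Jacobi triple product. -/
theorem jacobi_triple_product {q X Y : ℂ} (hq : ‖q‖ < 1) (hq0 : q ≠ 0) (hXY : X * Y = q) :
    1 + ∑' l : ℕ, q ^ (l + 1).choose 2 * ((-X) ^ (l + 1) + (-Y) ^ (l + 1)) =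
      qPochInf q q * (qPochInf X q * qPochInf Y q) := by
  obtain ⟨B, hB0, hB⟩ := exists_norm_gaussBinom_le hq
  have h0 := qPochInf_ne_zero hq (mul_pow_ne_one_of_norm_lt_one hq)
  have key := tendsto_tsum_of_dominated_convergence (𝓕 := atTop)
    (f := fun M l => gaussBinom q (2 * M) (M + (l + 1)) *
      (q ^ (l + 1).choose 2 * ((-X) ^ (l + 1) + (-Y) ^ (l + 1))))
    ((summable_theta hq X Y).mul_left B)
    (fun l => (tendsto_gaussBinom_two_mul hq (l + 1)).mul_const _)
    (Eventually.of_forall fun M l => by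
      rw [norm_mul]; exact mul_le_mul_of_nonneg_right (hB _ _) (norm_nonneg _))
  have h1 := (tendsto_gaussBinom_two_mul hq 0).add key
  have h2 := (tendsto_qPoch X hq).mul (tendsto_qPoch Y hq)
  have h3 := tendsto_nhds_unique h1 (h2.congr fun M => by
    rw [← finite_jacobi_triple_product hq hq0 hXY M, add_zero, tsum_eq_sum]
    intro l hl
    rw [gaussBinom_eq_zero_of_lt q (by simp at hl; omega), zero_mul])
  rw [tsum_mul_left] at h3
  rw [← h3]
  field_simp

/-! ### Bailey pairs: the Bailey lemma, change of parameter, the unit pair. -/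

/-- `(α, β)` is a Bailey pair relative to `A`. -/
def IsBaileyPair (A q : ℂ) (α β : ℕ → ℂ) : Prop :=
  ∀ N, β N = ∑ r ∈ Finset.range (N + 1),
    α r * ((qPoch q q (N - r))⁻¹ * (qPoch (A * q) q (N + r))⁻¹)

/-- The map on `β` in the limiting case of the Bailey lemma. -/
noncomputable def baileyStep (A q : ℂ) (β : ℕ → ℂ) (N : ℕ) : ℂ :=
  ∑ s ∈ Finset.range (N + 1), (qPoch q q (N - s))⁻¹ * (A ^ s * q ^ s ^ 2) * β s

/-- The sequence `δ_{n,0}`. -/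
def unitBeta (n : ℕ) : ℂ := if n = 0 then 1 else 0

theorem sum_range_sum_range_le {M : Type*} [AddCommMonoid M] (N : ℕ) (f : ℕ → ℕ → M) :
    ∑ s ∈ Finset.range (N + 1), ∑ r ∈ Finset.range (s + 1), f s r =
      ∑ r ∈ Finset.range (N + 1), ∑ m ∈ Finset.range (N - r + 1), f (r + m) r := by
  rw [Finset.sum_comm' (t' := Finset.range (N + 1)) (s' := fun r => Finset.Ico r (N + 1))]
  · refine Finset.sum_congr rfl fun r hr => ?_
    rw [Finset.sum_Ico_eq_sum_range, Nat.sub_add_comm (Nat.lt_succ_iff.1 (Finset.mem_range.1 hr))]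
  · intro s r
    simp only [Finset.mem_range, Finset.mem_Ico]
    omega

theorem mul_pow_ne_one_of_shift {A q : ℂ} (h : ∀ j : ℕ, A * q * q ^ j ≠ 1) (m j : ℕ) :
    A * q ^ m * q * q ^ j ≠ 1 := by
  have := h (m + j)
  rwa [show A * q ^ m * q * q ^ j = A * q * q ^ (m + j) by ring]

/-- The Bailey lemma with both parameters at infinity. -/
theorem IsBaileyPair.step {A q : ℂ} {α β : ℕ → ℂ} (hq : ‖q‖ < 1)
    (hA : ∀ j : ℕ, A * q * q ^ j ≠ 1) (h : IsBaileyPair A q α β) :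
    IsBaileyPair A q (fun r => A ^ r * q ^ r ^ 2 * α r) (baileyStep A q β) := by
  intro N
  simp only [baileyStep, h _, Finset.mul_sum]
  rw [sum_range_sum_range_le]
  refine Finset.sum_congr rfl fun r hr => ?_
  have hr : r ≤ N := Nat.lt_succ_iff.1 (Finset.mem_range.1 hr)
  -- After the interchange of sums, the coefficient of `α_r` is a sum over `m = s - r`. The cross
  -- term `2rm` of `(r + m)²` turns `A` into `A q^{2r}`.
  have key := sum_pow_sq_div_qPoch (c := A * q ^ (2 * r)) hq (mul_pow_ne_one_of_shift hA _) (N - r)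
  have e : A * q ^ (2 * r) * q = A * q * q ^ (2 * r) := by ring
  have e1 : qPoch (A * q) q (N + r) =
      qPoch (A * q) q (2 * r) * qPoch (A * q * q ^ (2 * r)) q (N - r) := by
    rw [← qPoch_add]; congr 1; omega
  rw [e1, mul_inv, mul_left_comm (qPoch q q (N - r))⁻¹, ← e, ← key, Finset.mul_sum,
    Finset.mul_sum]
  refine Finset.sum_congr rfl fun m _ => ?_
  rw [show N - (r + m) = N - r - m by omega, Nat.add_sub_cancel_left,
    show r + m + r = 2 * r + m by ring, qPoch_add, mul_inv, ← e]
  ring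

theorem IsBaileyPair.iterate {A q : ℂ} {α β : ℕ → ℂ} (hq : ‖q‖ < 1)
    (hA : ∀ j : ℕ, A * q * q ^ j ≠ 1) (h : IsBaileyPair A q α β) (m : ℕ) :
    IsBaileyPair A q (fun r => (A ^ r * q ^ r ^ 2) ^ m * α r) ((baileyStep A q)^[m] β) := by
  induction m with
  | zero => simpa using h
  | succ m ih =>
    rw [Function.iterate_succ_apply']
    convert ih.step hq hA using 2 with r
    ring

/-- The change of parameter from `A q` to `A`. -/
theorem IsBaileyPair.of_mul_q {A q : ℂ} {u β : ℕ → ℂ} (hq : ‖q‖ < 1)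
    (hA : ∀ j : ℕ, A * q * q ^ j ≠ 1)
    (h : IsBaileyPair (A * q) q (fun r => u r * (1 - A * q ^ (2 * r + 1)) / (1 - A * q)) β) :
    IsBaileyPair A q
      (fun r => u r - if r = 0 then 0 else A * q ^ (2 * r - 1) * u (r - 1)) β := by
  intro N
  have hA0 : (1 : ℂ) - A * q ≠ 0 := sub_ne_zero.2 (by simpa using (hA 0).symm)
  set D : ℕ → ℂ := fun r => (qPoch q q (N - r))⁻¹ * (qPoch (A * q) q (N + r))⁻¹ with hD
  -- The kernel splits because `1 - A q^{2r+1} = (1 - A q^{N+r+1}) - A q^{2r+1} (1 - q^{N-r})`. At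
  -- `r = N` the second part vanishes. The `if` records this, since `N - (r + 1)` would truncate to
  -- `0`.
  have e : ∀ r ∈ Finset.range (N + 1),
      u r * (1 - A * q ^ (2 * r + 1)) / (1 - A * q) *
        ((qPoch q q (N - r))⁻¹ * (qPoch (A * q * q) q (N + r))⁻¹) =
      u r * D r - if r < N then A * q ^ (2 * r + 1) * u r * D (r + 1) else 0 := by
    intro r hr
    have hr : r ≤ N := Nat.lt_succ_iff.1 (Finset.mem_range.1 hr)
    have h1 := qPoch_succ' (A * q) q (N + r)
    have h2 := qPoch_succ (A * q) q (N + r)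
    have h3 := qPoch_ne_zero hA (N + r)
    have h4 : (1 : ℂ) - A * q * q ^ (N + r) ≠ 0 := sub_ne_zero.2 (hA _).symm
    have h5 : qPoch (A * q * q) q (N + r) ≠ 0 := by
      intro h; rw [h, mul_zero, h2] at h1; exact mul_ne_zero h3 h4 h1
    have h6 : (1 - A * q)⁻¹ * (qPoch (A * q * q) q (N + r))⁻¹ =
        (qPoch (A * q) q (N + r))⁻¹ * (1 - A * q * q ^ (N + r))⁻¹ := by
      rw [← mul_inv, ← mul_inv, ← h1, h2]
    rw [div_eq_mul_inv, mul_assoc, mul_left_comm (1 - A * q)⁻¹, h6]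
    rcases hr.lt_or_eq with hlt | rfl
    · rw [if_pos hlt]
      obtain ⟨d, rfl⟩ := Nat.exists_eq_add_of_lt hlt
      simp only [hD]
      rw [show r + d + 1 - (r + 1) = d by omega, show r + d + 1 - r = d + 1 by omega,
        show r + d + 1 + (r + 1) = r + d + 1 + r + 1 by omega, h2, qPoch_succ q q d]
      have h7 := qPoch_self_ne_zero hq d
      have h8 : (1 : ℂ) - q * q ^ d ≠ 0 :=
        sub_ne_zero.2 (mul_pow_ne_one_of_norm_lt_one hq d).symm
      generalize qPoch (A * q) q (r + d + 1 + r) = y at h3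
      generalize qPoch q q d = y' at h7
      have h9 : (1 : ℂ) - A * q ^ (2 * r + d + 2) ≠ 0 := by
        convert h4 using 2; ring
      rw [show A * q * q ^ (r + d + 1 + r) = A * q ^ (2 * r + d + 2) by ring]
      rw [← pow_succ'] at h8 ⊢
      field_simp
      ring
    · rw [if_neg (lt_irrefl _), sub_zero]
      simp only [hD, Nat.sub_self, qPoch_zero]
      rw [show A * q * q ^ (r + r) = A * q ^ (2 * r + 1) by ring] at h4 ⊢
      field_simp
  rw [h N, Finset.sum_congr rfl e, Finset.sum_sub_distrib]
  simp only [sub_mul, Finset.sum_sub_distrib]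
  congr 1
  rw [Finset.sum_range_succ, Finset.sum_range_succ' _ N]
  simp only [lt_irrefl, if_false, if_true, zero_mul, add_zero, Nat.add_sub_cancel,
    Nat.succ_ne_zero]
  refine Finset.sum_congr rfl fun r hr => ?_
  rw [if_pos (Finset.mem_range.1 hr), show 2 * (r + 1) - 1 = 2 * r + 1 by omega]

/-- The sequence `(-1)^r q^{r(r-1)/2} (A q)_r / (q)_r`. -/
noncomputable def unitU (A q : ℂ) (r : ℕ) : ℂ :=
  (-1) ^ r * q ^ r.choose 2 * qPoch (A * q) q r * (qPoch q q r)⁻¹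

/-- The factor `1 - q^N` makes the partial sums closed products. The range stops at `R ≤ N`, where
`N - R` is a true difference; the term `r = N` is added separately in `isBaileyPair_unit`. -/
theorem sum_unitU_telescope {A q : ℂ} (hq : ‖q‖ < 1) (hA : ∀ j : ℕ, A * q * q ^ j ≠ 1)
    {N R : ℕ} (hR : R ≤ N) :
    ∑ r ∈ Finset.range R, unitU A q r * (1 - A * q ^ (2 * r + 1)) *
        ((qPoch q q (N - r))⁻¹ * (qPoch (A * q) q (N + r + 1))⁻¹) * (1 - q ^ N) =
      -(-1) ^ R * q ^ R.choose 2 * qPoch (A * q) q R * (qPoch q q R)⁻¹ * (1 - q ^ R) *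
        ((qPoch q q (N - R))⁻¹ * (qPoch (A * q) q (N + R))⁻¹) := by
  induction R with
  | zero => simp
  | succ R ih =>
    rw [Finset.sum_range_succ, ih (by omega)]
    obtain ⟨d, rfl⟩ := Nat.exists_eq_add_of_le' hR
    rw [show d + (R + 1) - (R + 1) = d by omega, show d + (R + 1) - R = d + 1 by omega,
      show d + (R + 1) + R = d + 2 * R + 1 by omega,
      show d + (R + 1) + (R + 1) = d + 2 * R + 1 + 1 by omega,
      Nat.choose_succ_succ' R 1, Nat.choose_one_right, unitU,
      qPoch_succ q q d, qPoch_succ q q R, qPoch_succ (A * q) q R,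
      qPoch_succ (A * q) q (d + 2 * R + 1)]
    have h1 := qPoch_self_ne_zero hq d
    have h2 := qPoch_self_ne_zero hq R
    have h3 := qPoch_ne_zero hA (d + 2 * R + 1)
    have h4 : (1 : ℂ) - q * q ^ d ≠ 0 :=
      sub_ne_zero.2 (mul_pow_ne_one_of_norm_lt_one hq d).symm
    have h5 : (1 : ℂ) - q * q ^ R ≠ 0 :=
      sub_ne_zero.2 (mul_pow_ne_one_of_norm_lt_one hq R).symm
    have h6 : (1 : ℂ) - A * q * q ^ (d + 2 * R + 1) ≠ 0 := sub_ne_zero.2 (hA _).symm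
    rw [← pow_succ'] at h4 h5 ⊢
    rw [← pow_succ']
    rw [show A * q * q ^ (d + 2 * R + 1) = A * q ^ (d + 2 * R + 2) by ring] at h6 ⊢
    generalize qPoch (A * q) q (d + 2 * R + 1) = y at *
    generalize qPoch (A * q) q R = y'
    field_simp
    ring

/-- The unit Bailey pair relative to `A q`. -/
theorem isBaileyPair_unit {A q : ℂ} (hq : ‖q‖ < 1) (hA : ∀ j : ℕ, A * q * q ^ j ≠ 1) :
    IsBaileyPair (A * q) q
      (fun r => unitU A q r * (1 - A * q ^ (2 * r + 1)) / (1 - A * q)) unitBeta := by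
  intro N
  have hA0 : (1 : ℂ) - A * q ≠ 0 := sub_ne_zero.2 (by simpa using (hA 0).symm)
  rcases Nat.eq_zero_or_pos N with rfl | hN
  · simp [unitBeta, unitU, qPoch_zero, hA0]
  rw [unitBeta, if_neg hN.ne']
  have hN1 : (1 : ℂ) - q ^ N ≠ 0 :=
    sub_ne_zero.2 (pow_ne_one_of_norm_lt_one hq hN.ne').symm
  have h6 : ∀ r, (1 - A * q)⁻¹ * (qPoch (A * q * q) q (N + r))⁻¹ =
      (qPoch (A * q) q (N + r + 1))⁻¹ := fun r => by rw [← mul_inv, ← qPoch_succ']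
  have e : ∀ r ∈ Finset.range (N + 1), unitU A q r * (1 - A * q ^ (2 * r + 1)) / (1 - A * q) *
      ((qPoch q q (N - r))⁻¹ * (qPoch (A * q * q) q (N + r))⁻¹) =
      unitU A q r * (1 - A * q ^ (2 * r + 1)) *
        ((qPoch q q (N - r))⁻¹ * (qPoch (A * q) q (N + r + 1))⁻¹) := fun r _ => by
    rw [← h6]; ring
  rw [Finset.sum_congr rfl e]
  symm
  apply (mul_eq_zero_iff_right hN1).1
  rw [Finset.sum_mul, Finset.sum_range_succ, sum_unitU_telescope hq hA le_rfl, unitU,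
    qPoch_succ (A * q) q (N + N)]
  have h3 := qPoch_ne_zero hA (N + N)
  have h4 : (1 : ℂ) - A * q * q ^ (N + N) ≠ 0 := sub_ne_zero.2 (hA _).symm
  rw [show A * q * q ^ (N + N) = A * q ^ (2 * N + 1) by ring] at h4 ⊢
  field_simp
  ring

/-! ### Insertion of a Bailey pair into an infinite sum. -/

theorem tsum_sum_antidiagonal {G : ℕ × ℕ → ℂ} (hG : Summable G) :
    ∑' N, ∑ x ∈ Finset.HasAntidiagonal.antidiagonal N, G x = ∑' r, ∑' m, G (r, m) := by
  rw [← hG.tsum_prod, ← Finset.HasAntidiagonal.sigmaAntidiagonalEquivProd.tsum_eq]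
  have h := ((Finset.HasAntidiagonal.sigmaAntidiagonalEquivProd (A := ℕ)).summable_iff.2
    hG).tsum_sigma' fun N => (hasSum_fintype _).summable
  refine Eq.trans (tsum_congr fun N => ?_) h.symm
  rw [tsum_fintype, ← Finset.sum_coe_sort]
  rfl

/-- The weight that the `₁φ₁` summation attaches to `α_r`. -/
noncomputable def baileyWeight (A p : ℂ) (r : ℕ) : ℂ :=
  A ^ r * qPoch (-p) (p ^ 2) r * p ^ r ^ 2 * qPochInf (-(A * p ^ (2 * r + 1))) (p ^ 2) *
    (qPochInf (A * p ^ 2) (p ^ 2))⁻¹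

theorem norm_sq_lt_one {p : ℂ} (hp : ‖p‖ < 1) : ‖p ^ 2‖ < 1 := by
  rw [norm_pow]; exact pow_lt_one₀ (norm_nonneg p) hp two_ne_zero

theorem tsum_baileyWeight {A p : ℂ} (hp : ‖p‖ < 1) (hA : ∀ j : ℕ, A * p ^ 2 * (p ^ 2) ^ j ≠ 1)
    (r : ℕ) :
    ∑' m : ℕ, A ^ (r + m) * qPoch (-p) (p ^ 2) (r + m) * p ^ (r + m) ^ 2 *
      ((qPoch (p ^ 2) (p ^ 2) m)⁻¹ * (qPoch (A * p ^ 2) (p ^ 2) (r + m + r))⁻¹) =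
      baileyWeight A p r := by
  have hq := norm_sq_lt_one hp
  -- Here `z = A p^{2r+1}` and `w = z p^{2r+1}`, so `z + w q^j = z (1 + p^{2r+1} q^j)` produces the
  -- tail of `(-p; q)_{r+m}`.
  have key := tsum_vandermonde hq (A * p ^ (2 * r + 1)) (A * p ^ 2 * (p ^ 2) ^ (2 * r))
  rw [baileyWeight, ← key, mul_right_comm, ← tsum_mul_left]
  refine tsum_congr fun m => ?_
  have h1 : ∏ j ∈ Finset.range m,
      (A * p ^ (2 * r + 1) + A * p ^ 2 * (p ^ 2) ^ (2 * r) * (p ^ 2) ^ j) =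
      (A * p ^ (2 * r + 1)) ^ m * qPoch (-p * (p ^ 2) ^ r) (p ^ 2) m := by
    rw [qPoch, ← Finset.card_range m, ← Finset.prod_const, Finset.card_range,
      ← Finset.prod_mul_distrib]
    exact Finset.prod_congr rfl fun j _ => by ring
  have h2 := qPoch_mul_qPochInf (A * p ^ 2) hq (r + m + r)
  have h3 := qPoch_ne_zero hA (r + m + r)
  have h4 := qPochInf_ne_zero hq hA
  have h5 : (qPoch (A * p ^ 2) (p ^ 2) (r + m + r))⁻¹ = (qPochInf (A * p ^ 2) (p ^ 2))⁻¹ *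
      qPochInf (A * p ^ 2 * (p ^ 2) ^ (r + m + r)) (p ^ 2) := by
    rw [inv_mul_eq_div, inv_eq_one_div, div_eq_div_iff h3 h4, ← h2]
    ring
  rw [h1, h5, qPoch_add, show A * p ^ 2 * (p ^ 2) ^ (2 * r) * (p ^ 2) ^ m =
    A * p ^ 2 * (p ^ 2) ^ (r + m + r) by ring]
  have h6 : p ^ (r + m) ^ 2 = p ^ r ^ 2 * (p ^ (2 * r + 1)) ^ m * (p ^ 2) ^ m.choose 2 := by
    rw [← pow_mul, ← pow_mul, ← pow_add, ← pow_add]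
    congr 1
    linarith [choose_two_add_choose_two_add_self m]
  rw [h6]
  ring

theorem geomBounded_qPochInf_neg (A : ℂ) {p : ℂ} (hp : ‖p‖ < 1) :
    GeomBounded fun r => qPochInf (-(A * p ^ (2 * r + 1))) (p ^ 2) := by
  refine GeomBounded.of_bounded (C := Real.exp (‖-(A * p)‖ * (1 - ‖p ^ 2‖)⁻¹)) fun r => ?_
  rw [show -(A * p ^ (2 * r + 1)) = -(A * p) * (p ^ 2) ^ r by ring]
  exact norm_qPochInf_mul_pow_le (-(A * p)) (norm_sq_lt_one hp) r

theorem summable_baileyWeight_mul {A p : ℂ} {α : ℕ → ℂ} (hp : ‖p‖ < 1) (hα : GeomBounded α) :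
    Summable fun r => baileyWeight A p r * α r := by
  have hq := norm_sq_lt_one hp
  have h : GeomBounded fun r => A ^ r * qPoch (-p) (p ^ 2) r *
      qPochInf (-(A * p ^ (2 * r + 1))) (p ^ 2) * (qPochInf (A * p ^ 2) (p ^ 2))⁻¹ * α r :=
    ((((GeomBounded.pow A).mul (geomBounded_qPoch _ hq)).mul (geomBounded_qPochInf_neg A hp)).mul
      (.of_bounded fun _ => le_rfl)).mul hα
  refine (h.summable_norm_pow_sq_mul hp).of_norm.congr fun r => ?_
  rw [baileyWeight]; ring

/-- Insertion of a Bailey pair into the `₁φ₁` summation. -/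
theorem IsBaileyPair.tsum_eq {A p : ℂ} {α β : ℕ → ℂ} (hp : ‖p‖ < 1)
    (hA : ∀ j : ℕ, A * p ^ 2 * (p ^ 2) ^ j ≠ 1) (h : IsBaileyPair A (p ^ 2) α β)
    (hα : GeomBounded α) :
    ∑' N, A ^ N * qPoch (-p) (p ^ 2) N * p ^ N ^ 2 * β N = ∑' r, baileyWeight A p r * α r := by
  have hq := norm_sq_lt_one hp
  set G : ℕ × ℕ → ℂ := fun x => A ^ (x.1 + x.2) * qPoch (-p) (p ^ 2) (x.1 + x.2) *
    p ^ (x.1 + x.2) ^ 2 * ((qPoch (p ^ 2) (p ^ 2) x.2)⁻¹ *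
      (qPoch (A * p ^ 2) (p ^ 2) (x.1 + x.2 + x.1))⁻¹) * α x.1 with hG
  have hsum : Summable G := by
    have s1 := ((GeomBounded.pow A).mul hα).summable_norm_pow_sq_mul hp
    have s2 := (GeomBounded.pow A).summable_norm_pow_sq_mul hp
    obtain ⟨C, hC0, hC⟩ := exists_norm_inv_qPoch_le hq (mul_pow_ne_one_of_norm_lt_one hq)
    obtain ⟨C', hC0', hC'⟩ := exists_norm_inv_qPoch_le hq hA
    set E := Real.exp (‖-p‖ * (1 - ‖p ^ 2‖)⁻¹)
    refine Summable.of_norm_bounded ((s1.mul_of_nonneg s2 (fun _ => norm_nonneg _)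
      (fun _ => norm_nonneg _)).mul_left (E * (C * C'))) fun x => ?_
    obtain ⟨r, m⟩ := x
    simp only [hG, norm_mul, norm_pow]
    -- Dropping the cross term `2rm` separates the variables, so a product of two summable series
    -- dominates and the sums may be interchanged.
    have h1 : ‖p‖ ^ (r + m) ^ 2 ≤ ‖p‖ ^ r ^ 2 * ‖p‖ ^ m ^ 2 := by
      rw [← pow_add]
      exact pow_le_pow_of_le_one (norm_nonneg p) hp.le (by nlinarith [Nat.zero_le (r * m)])
    calc _ ≤ ‖A‖ ^ (r + m) * E * (‖p‖ ^ r ^ 2 * ‖p‖ ^ m ^ 2) * (C * C') * ‖α r‖ := by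
          gcongr
          · exact norm_qPoch_le _ hq _
          · exact hC _
          · exact hC' _
      _ = _ := by ring
  calc _ = ∑' N, ∑ x ∈ Finset.HasAntidiagonal.antidiagonal N, G x := by
        refine tsum_congr fun N => ?_
        rw [h N, Finset.mul_sum, Finset.Nat.sum_antidiagonal_eq_sum_range_succ_mk]
        refine Finset.sum_congr rfl fun r hr => ?_
        have hr : r ≤ N := Nat.lt_succ_iff.1 (Finset.mem_range.1 hr)
        simp only [hG, Nat.add_sub_cancel' hr]
        ring
    _ = _ := by
        rw [tsum_sum_antidiagonal hsum]
        refine tsum_congr fun r => ?_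
        simp only [hG]
        rw [tsum_mul_right, tsum_baileyWeight hp hA]

/-! ### Multisums over chains as iterated sums. -/

theorem entry_cons_one {m : ℕ} (N : ℕ) (t : Fin m → ℕ) :
    entry (Fin.cons N t : Fin (m + 1) → ℕ) 1 = N := by
  simp only [entry, show 0 < 1 ∧ 1 ≤ m + 1 by omega, dif_pos, and_self]
  rfl

theorem entry_cons_succ {m : ℕ} (N : ℕ) (t : Fin m → ℕ) {j : ℕ} (hj : 1 ≤ j) :
    entry (Fin.cons N t : Fin (m + 1) → ℕ) (j + 1) = entry t j := by
  unfold entry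
  by_cases h : j ≤ m
  · rw [dif_pos ⟨by omega, by omega⟩, dif_pos ⟨by omega, h⟩]
    have : (⟨j + 1 - 1, by omega⟩ : Fin (m + 1)) = Fin.succ ⟨j - 1, by omega⟩ := by
      ext; simp; omega
    rw [this, Fin.cons_succ]
  · rw [dif_neg (by omega), dif_neg (by omega)]

theorem prod_Icc_one_succ {M : Type*} [CommMonoid M] (m : ℕ) (f : ℕ → M) :
    ∏ j ∈ Finset.Icc 1 (m + 1), f j = f 1 * ∏ j ∈ Finset.Icc 1 m, f (j + 1) := by
  induction m with
  | zero => simp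
  | succ m ih =>
    rw [Finset.prod_Icc_succ_top (by omega), ih, Finset.prod_Icc_succ_top (by omega), mul_assoc]

/-- A chain product with a weight `w j` attached to the `j`-th entry. -/
noncomputable def chainTerm (q : ℂ) (w : ℕ → ℕ → ℂ) {m : ℕ} (s : Fin m → ℕ) : ℂ :=
  (∏ j ∈ Finset.Icc 1 m, w j (entry s j)) * chainWeight q s

theorem chainTerm_congr (q : ℂ) {w w' : ℕ → ℕ → ℂ} (h : ∀ j, 1 ≤ j → w j = w' j) {m : ℕ}
    (s : Fin m → ℕ) : chainTerm q w s = chainTerm q w' s := by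
  unfold chainTerm
  congr 1
  exact Finset.prod_congr rfl fun j hj => by rw [h j (Finset.mem_Icc.1 hj).1]

theorem chainTerm_cons (q : ℂ) (w : ℕ → ℕ → ℂ) {m : ℕ} (N : ℕ) (t : Fin m → ℕ) :
    chainTerm q w (Fin.cons N t : Fin (m + 1) → ℕ) =
      w 1 N * (invQFact q N (entry t 1) * chainTerm q (fun j => w (j + 1)) t) := by
  unfold chainTerm chainWeight
  rw [prod_Icc_one_succ, prod_Icc_one_succ, entry_cons_one, entry_cons_succ N t le_rfl]
  have h1 : ∀ j ∈ Finset.Icc 1 m, w (j + 1) (entry (Fin.cons N t : Fin (m + 1) → ℕ) (j + 1)) =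
      w (j + 1) (entry t j) := fun j hj => by
    rw [entry_cons_succ N t (Finset.mem_Icc.1 hj).1]
  have h2 : ∀ j ∈ Finset.Icc 1 m,
      invQFact q (entry (Fin.cons N t : Fin (m + 1) → ℕ) (j + 1))
        (entry (Fin.cons N t : Fin (m + 1) → ℕ) (j + 1 + 1)) =
      invQFact q (entry t j) (entry t (j + 1)) := fun j hj => by
    rw [entry_cons_succ N t (Finset.mem_Icc.1 hj).1, entry_cons_succ N t (by omega)]
  rw [Finset.prod_congr rfl h1, Finset.prod_congr rfl h2]
  ring

theorem summable_prod_entry {m : ℕ} {g : ℕ → ℕ → ℝ} (h0 : ∀ j n, 0 ≤ g j n)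
    (hg : ∀ j, Summable (g j)) :
    Summable fun s : Fin m → ℕ => ∏ j ∈ Finset.Icc 1 m, g j (entry s j) := by
  induction m generalizing g with
  | zero => exact (hasSum_fintype _).summable
  | succ m ih =>
    rw [← (Fin.consEquiv fun _ => ℕ).summable_iff]
    have := (hg 1).mul_of_nonneg (ih (g := fun j => g (j + 1)) (fun j => h0 _) fun j => hg _)
      (h0 1) (fun s => Finset.prod_nonneg fun j _ => h0 _ _)
    refine this.congr fun x => ?_
    obtain ⟨N, t⟩ := x
    rw [Function.comp_apply,
      show (Fin.consEquiv fun _ => ℕ) (N, t) = (Fin.cons N t : Fin (m + 1) → ℕ) from rfl,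
      prod_Icc_one_succ, entry_cons_one]
    congr 1
    exact Finset.prod_congr rfl fun j hj => by
      rw [entry_cons_succ N t (Finset.mem_Icc.1 hj).1]

/-- The inverse factorials are uniformly bounded, so the multisum is dominated by a product of
one-variable series. -/
theorem summable_chainTerm {q : ℂ} (hq : ‖q‖ < 1) {w : ℕ → ℕ → ℂ}
    (hw : ∀ j, Summable fun n => ‖w j n‖) {m : ℕ} :
    Summable fun s : Fin m → ℕ => chainTerm q w s := by
  obtain ⟨C, hC0, hC⟩ := exists_norm_inv_qPoch_le hq (mul_pow_ne_one_of_norm_lt_one hq)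
  refine Summable.of_norm_bounded (summable_prod_entry (g := fun j n => ‖w j n‖ * C)
    (fun j n => by positivity) fun j => (hw j).mul_right C) fun s => ?_
  rw [chainTerm, chainWeight, ← Finset.prod_mul_distrib, norm_prod]
  refine Finset.prod_le_prod (fun _ _ => norm_nonneg _) fun j _ => ?_
  rw [norm_mul]
  refine mul_le_mul_of_nonneg_left ?_ (norm_nonneg _)
  unfold invQFact
  split_ifs
  · exact hC _
  · simpa using hC0

theorem tsum_chainTerm_succ {q : ℂ} (hq : ‖q‖ < 1) {w : ℕ → ℕ → ℂ}
    (hw : ∀ j, Summable fun n => ‖w j n‖) (m : ℕ) :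
    ∑' s : Fin (m + 1) → ℕ, chainTerm q w s = ∑' N, w 1 N *
      ∑' t : Fin m → ℕ, invQFact q N (entry t 1) * chainTerm q (fun j => w (j + 1)) t := by
  have hs := summable_chainTerm hq hw (m := m + 1)
  rw [← (Fin.consEquiv fun _ => ℕ).summable_iff] at hs
  rw [← (Fin.consEquiv fun _ => ℕ).tsum_eq]
  refine hs.tsum_prod.trans (tsum_congr fun N => ?_)
  rw [← tsum_mul_left]
  refine tsum_congr fun t => ?_
  exact chainTerm_cons q w N t

/-- The iterated finite sum over the chains `N ≥ s_1 ≥ ⋯ ≥ s_m`. -/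
noncomputable def nestedSum (q : ℂ) : (ℕ → ℕ → ℂ) → ℕ → ℕ → ℂ
  | _, 0, N => (qPoch q q N)⁻¹
  | w, m + 1, N => ∑ s ∈ Finset.range (N + 1),
      (qPoch q q (N - s))⁻¹ * w 1 s * nestedSum q (fun j => w (j + 1)) m s

theorem tsum_invQFact_mul_chainTerm {q : ℂ} (hq : ‖q‖ < 1) {w : ℕ → ℕ → ℂ}
    (hw : ∀ j, Summable fun n => ‖w j n‖) (m N : ℕ) :
    ∑' t : Fin m → ℕ, invQFact q N (entry t 1) * chainTerm q w t = nestedSum q w m N := by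
  induction m generalizing w N with
  | zero =>
    rw [tsum_fintype]
    simp [chainTerm, chainWeight, invQFact, entry, nestedSum]
  | succ m ih =>
    obtain ⟨C, hC0, hC⟩ := exists_norm_inv_qPoch_le hq (mul_pow_ne_one_of_norm_lt_one hq)
    -- The link from `N` to the first entry is absorbed into the first weight, which makes the sum a
    -- plain chain sum again and cuts it off at `s ≤ N`.
    set w' : ℕ → ℕ → ℂ := fun j s => if j = 1 then invQFact q N s * w 1 s else w j s with hw'
    have hsw : ∀ j, Summable fun n => ‖w' j n‖ := by
      intro j
      by_cases hj : j = 1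
      · subst hj
        refine Summable.of_nonneg_of_le (fun _ => norm_nonneg _) (fun n => ?_)
          ((hw 1).mul_left C)
        simp only [hw', if_true, norm_mul]
        refine mul_le_mul_of_nonneg_right ?_ (norm_nonneg _)
        unfold invQFact
        split_ifs
        · exact hC _
        · simpa using hC0
      · simpa only [hw', if_neg hj] using hw j
    have e : ∀ t : Fin (m + 1) → ℕ, invQFact q N (entry t 1) * chainTerm q w t =
        chainTerm q w' t := by
      intro t
      unfold chainTerm
      rw [prod_Icc_one_succ, prod_Icc_one_succ]
      have : ∀ j ∈ Finset.Icc 1 m, w' (j + 1) (entry t (j + 1)) = w (j + 1) (entry t (j + 1)) :=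
        fun j hj => by
          have := (Finset.mem_Icc.1 hj).1
          simp only [hw', if_neg (show j + 1 ≠ 1 by omega)]
      rw [Finset.prod_congr rfl this]
      simp only [hw', if_true]
      ring
    rw [tsum_congr e, tsum_chainTerm_succ hq hsw, nestedSum, tsum_eq_sum
      (s := Finset.range (N + 1))]
    · refine Finset.sum_congr rfl fun s hs => ?_
      have hs : s ≤ N := Nat.lt_succ_iff.1 (Finset.mem_range.1 hs)
      rw [← ih (w := fun j => w (j + 1)) (fun j => hw _)]
      simp only [hw', if_true, invQFact, if_pos hs]
      congr 1
      refine tsum_congr fun t => ?_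
      congr 1
      exact chainTerm_congr q (fun j hj => by
        funext s; simp only [if_neg (show j + 1 ≠ 1 by omega)]) t
    · intro s hs
      have hs : ¬ s ≤ N := by simpa using hs
      simp only [hw', if_true, invQFact, if_neg hs, zero_mul]

theorem tsum_chainTerm {q : ℂ} (hq : ‖q‖ < 1) {w : ℕ → ℕ → ℂ}
    (hw : ∀ j, Summable fun n => ‖w j n‖) (m : ℕ) :
    ∑' s : Fin (m + 1) → ℕ, chainTerm q w s =
      ∑' N, w 1 N * nestedSum q (fun j => w (j + 1)) m N := by
  rw [tsum_chainTerm_succ hq hw]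
  exact tsum_congr fun N => by rw [tsum_invQFact_mul_chainTerm hq fun j => hw _]

/-! ### Summing out interlaced variables; iterated sums as Bailey steps. -/

/-- The finite `q`-binomial theorem at `p^{2t+1}`: it removes a variable `t + m` lying between `t`
and `t + M` in a chain. -/
theorem sum_pow_sq_mul_inv_qPoch {p : ℂ} (hp : ‖p‖ < 1) (t M : ℕ) :
    ∑ m ∈ Finset.range (M + 1), (qPoch (p ^ 2) (p ^ 2) (M - m))⁻¹ * p ^ (t + m) ^ 2 *
      (qPoch (p ^ 2) (p ^ 2) m)⁻¹ =
      p ^ t ^ 2 * qPoch (-p * (p ^ 2) ^ t) (p ^ 2) M * (qPoch (p ^ 2) (p ^ 2) M)⁻¹ := by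
  have hq := norm_sq_lt_one hp
  have h := sum_gaussBinom_mul_pow (p ^ 2) (p ^ (2 * t + 1)) M
  rw [show -p * (p ^ 2) ^ t = -p ^ (2 * t + 1) by ring, ← h, Finset.mul_sum, Finset.sum_mul]
  refine Finset.sum_congr rfl fun m hm => ?_
  have hm : m ≤ M := Nat.lt_succ_iff.1 (Finset.mem_range.1 hm)
  have h6 : p ^ (t + m) ^ 2 = p ^ t ^ 2 * ((p ^ 2) ^ m.choose 2 * (p ^ (2 * t + 1)) ^ m) := by
    rw [← pow_mul, ← pow_mul, ← pow_add, ← pow_add]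
    congr 1
    linarith [choose_two_add_choose_two_add_self m]
  have hM := qPoch_self_ne_zero hq M
  rw [gaussBinom_eq_div hq hm, h6]
  field_simp

/-- Weights `p^{s²}` at all indices, with `v l` attached to the even index `2 l`. -/
def interlacedWeight (p : ℂ) (v : ℕ → ℕ → ℂ) (j s : ℕ) : ℂ :=
  p ^ s ^ 2 * if Even j then v (j / 2) s else 1

/-- Summation over the entries with odd indices. -/
theorem nestedSum_interlacedWeight {p : ℂ} (hp : ‖p‖ < 1) (v : ℕ → ℕ → ℂ) (m N : ℕ) :
    nestedSum (p ^ 2) (interlacedWeight p v) (2 * m + 1) N =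
      qPoch (-p) (p ^ 2) N *
        nestedSum (p ^ 2) (fun j s => v j s * (p ^ 2) ^ s ^ 2) m N := by
  induction m generalizing v N with
  | zero =>
    have := sum_pow_sq_mul_inv_qPoch hp 0 N
    simpa [nestedSum, interlacedWeight] using this
  | succ m ih =>
    have hw : (fun j => interlacedWeight p v (j + 1 + 1)) =
        interlacedWeight p (fun l => v (l + 1)) := by
      funext j s
      simp only [interlacedWeight, Nat.even_add_one, not_not,
        show (j + 1 + 1) / 2 = j / 2 + 1 by omega]
    rw [show 2 * (m + 1) + 1 = 2 * m + 1 + 1 + 1 by ring, nestedSum]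
    have hn : ∀ s, nestedSum (p ^ 2) (fun j => interlacedWeight p v (j + 1)) (2 * m + 1 + 1) s =
        ∑ t ∈ Finset.range (s + 1), (qPoch (p ^ 2) (p ^ 2) (s - t))⁻¹ * interlacedWeight p v 2 t *
          nestedSum (p ^ 2) (fun j => interlacedWeight p v (j + 1 + 1)) (2 * m + 1) t :=
      fun s => rfl
    simp only [hn, Finset.mul_sum]
    rw [sum_range_sum_range_le, nestedSum, Finset.mul_sum, hw]
    refine Finset.sum_congr rfl fun t ht => ?_
    have ht : t ≤ N := Nat.lt_succ_iff.1 (Finset.mem_range.1 ht)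
    have h1 := sum_pow_sq_mul_inv_qPoch hp t (N - t)
    have h2 : qPoch (-p) (p ^ 2) N =
        qPoch (-p) (p ^ 2) t * qPoch (-p * (p ^ 2) ^ t) (p ^ 2) (N - t) := by
      rw [← qPoch_add, Nat.add_sub_cancel' ht]
    rw [ih, h2]
    -- The inner sum yields a second `p^{t²}`, which with the weight of `t` makes `q^{t²}`, and the
    -- factor extending `(-p; q)_t` to `(-p; q)_N`.
    calc _ = (∑ m ∈ Finset.range (N - t + 1), (qPoch (p ^ 2) (p ^ 2) (N - t - m))⁻¹ *
          p ^ (t + m) ^ 2 * (qPoch (p ^ 2) (p ^ 2) m)⁻¹) * (p ^ t ^ 2 * v 1 t *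
          (qPoch (-p) (p ^ 2) t * nestedSum (p ^ 2)
            (fun j s => v (j + 1) s * (p ^ 2) ^ s ^ 2) m t)) := by
          rw [Finset.sum_mul]
          refine Finset.sum_congr rfl fun m _ => ?_
          rw [show N - (t + m) = N - t - m by omega, Nat.add_sub_cancel_left]
          simp [interlacedWeight]
          ring
      _ = _ := by rw [h1]; ring

theorem baileyStep_unitBeta (A q : ℂ) (N : ℕ) :
    baileyStep A q unitBeta N = (qPoch q q N)⁻¹ := by
  rw [baileyStep, Finset.sum_eq_single 0]
  · simp [unitBeta]
  · intro s _ hs; simp [unitBeta, hs]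
  · simp

/-- The weights `a^s q^{s²}`, with an additional factor `q^s` from the index `i` on. -/
def latticeWeight (a q : ℂ) (i j s : ℕ) : ℂ :=
  a ^ s * (if i ≤ j then q ^ s else 1) * q ^ s ^ 2

theorem latticeWeight_succ (a q : ℂ) (i : ℕ) :
    (fun j => latticeWeight a q i (j + 1)) = latticeWeight a q (i - 1) := by
  funext j s
  simp only [latticeWeight, tsub_le_iff_right]

/-- There is one step more than there are variables: the innermost factor `1/(q; q)_N` is itself a
Bailey step applied to `unitBeta`. -/
theorem nestedSum_latticeWeight_of_le_one (a q : ℂ) {i : ℕ} (hi : i ≤ 1) (m : ℕ) :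
    nestedSum q (latticeWeight a q i) m = (baileyStep (a * q) q)^[m + 1] unitBeta := by
  induction m generalizing i with
  | zero => funext N; exact (baileyStep_unitBeta _ _ _).symm
  | succ m ih =>
    funext N
    rw [Function.iterate_succ_apply', ← ih (i := i - 1) (by omega), nestedSum, baileyStep,
      latticeWeight_succ]
    simp only [latticeWeight, if_pos hi, mul_pow]

theorem nestedSum_latticeWeight (a q : ℂ) {l m : ℕ} (h : l ≤ m) :
    nestedSum q (latticeWeight a q (l + 1)) m =
      (baileyStep a q)^[l] ((baileyStep (a * q) q)^[m - l + 1] unitBeta) := by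
  induction l generalizing m with
  | zero => exact nestedSum_latticeWeight_of_le_one a q le_rfl m
  | succ l ih =>
    obtain ⟨m, rfl⟩ := Nat.exists_eq_add_of_le' (show 1 ≤ m by omega)
    funext N
    rw [Function.iterate_succ_apply', show m + 1 - (l + 1) = m - l by omega,
      ← ih (show l ≤ m by omega), nestedSum, baileyStep, latticeWeight_succ]
    simp [latticeWeight]

theorem nestedSum_congr (q : ℂ) {w w' : ℕ → ℕ → ℂ} (h : ∀ j, 1 ≤ j → w j = w' j) (m N : ℕ) :
    nestedSum q w m N = nestedSum q w' m N := by
  induction m generalizing w w' N with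
  | zero => rfl
  | succ m ih =>
    simp only [nestedSum, h 1 le_rfl]
    exact Finset.sum_congr rfl fun s _ => by rw [ih fun j hj => h (j + 1) (by omega)]

theorem prod_Icc_ite_pow (x : ℂ) {i : ℕ} (hi : 1 ≤ i) (n : ℕ) (g : ℕ → ℕ) :
    ∏ l ∈ Finset.Icc 1 n, (if i ≤ l then x ^ g l else 1) = x ^ ∑ l ∈ Finset.Icc i n, g l := by
  rw [← Finset.prod_filter, Finset.prod_pow_eq_pow_sum]
  congr 2
  ext l
  simp only [Finset.mem_filter, Finset.mem_Icc]
  omega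

theorem prod_Icc_two_mul {M : Type*} [CommMonoid M] (n : ℕ) (f : ℕ → M) :
    ∏ j ∈ Finset.Icc 1 (2 * n), f j = ∏ l ∈ Finset.Icc 1 n, (f (2 * l - 1) * f (2 * l)) := by
  induction n with
  | zero => simp
  | succ n ih =>
    rw [Finset.prod_Icc_succ_top (by omega), ← ih, show 2 * (n + 1) = 2 * n + 1 + 1 by ring,
      Finset.prod_Icc_succ_top (by omega), Finset.prod_Icc_succ_top (by omega), mul_assoc]
    rfl

/-! ### The two multisums of the theorem as chain sums. -/

/-- The weights of the `(k - 1)`-fold multisum. -/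
noncomputable def weightOne (i : ℕ) (p a : ℂ) (j s : ℕ) : ℂ :=
  a ^ s * (if j = 1 then qPoch (-p) (p ^ 2) s * p ^ s ^ 2 else (p ^ 2) ^ s ^ 2) *
    (if i ≤ j then (p ^ 2) ^ s else 1)

/-- The weights of the `(2k - 2)`-fold multisum. -/
noncomputable def weightTwo (i : ℕ) (p a : ℂ) (j s : ℕ) : ℂ :=
  p ^ s ^ 2 * if Odd j then a ^ s * (if i ≤ (j + 1) / 2 then (p ^ 2) ^ s else 1) else 1

theorem multiTermOne_eq_chainTerm (k : ℕ) {i : ℕ} (hi : 1 ≤ i) (p a : ℂ) (s : Fin (k - 1) → ℕ) :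
    multiTermOne k i p a s = chainTerm (p ^ 2) (weightOne i p a) s := by
  have h : ∏ j ∈ Finset.Icc 1 (k - 1),
      (if j = 1 then qPoch (-p) (p ^ 2) (entry s j) * p ^ entry s j ^ 2
        else (p ^ 2) ^ entry s j ^ 2) =
      qPoch (-p) (p ^ 2) (entry s 1) * p ^ entry s 1 ^ 2 *
        (p ^ 2) ^ ∑ j ∈ Finset.Icc 2 (k - 1), entry s j ^ 2 := by
    -- Without indices, `entry s 1` defaults to `0`, so the factors singled out for the first index
    -- are `1`.
    rcases Nat.eq_zero_or_pos (k - 1) with h0 | h0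
    · have : entry s 1 = 0 := by simp [entry, h0]
      simp [this, h0, qPoch_zero]
    · rw [← Finset.insert_Icc_succ_left_eq_Icc h0, Finset.prod_insert (by simp),
        ← Finset.prod_pow_eq_pow_sum]
      simp only [if_true]
      congr 1
      refine Finset.prod_congr rfl fun j hj => ?_
      have : 2 ≤ j := (Finset.mem_Icc.1 hj).1
      rw [if_neg (by omega)]
  rw [multiTermOne, chainTerm]
  simp only [weightOne, Finset.prod_mul_distrib]
  rw [h, prod_Icc_ite_pow _ hi, Finset.prod_pow_eq_pow_sum, pow_add]
  ring

theorem multiTermTwo_eq_chainTerm (k : ℕ) {i : ℕ} (hi : 1 ≤ i) (p a : ℂ)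
    (s : Fin (2 * k - 2) → ℕ) :
    multiTermTwo k i p a s = chainTerm (p ^ 2) (weightTwo i p a) s := by
  have h : ∏ j ∈ Finset.Icc 1 (2 * k - 2),
      (if Odd j then a ^ entry s j * (if i ≤ (j + 1) / 2 then (p ^ 2) ^ entry s j else 1) else 1) =
      ∏ l ∈ Finset.Icc 1 (k - 1), (a ^ entry s (2 * l - 1) *
        (if i ≤ l then (p ^ 2) ^ entry s (2 * l - 1) else 1)) := by
    generalize entry s = e
    rw [show 2 * k - 2 = 2 * (k - 1) by omega, prod_Icc_two_mul]
    refine Finset.prod_congr rfl fun l hl => ?_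
    have : 1 ≤ l := (Finset.mem_Icc.1 hl).1
    rw [if_pos (show Odd (2 * l - 1) by rw [Nat.odd_iff]; omega),
      if_neg (show ¬ Odd (2 * l) by rw [Nat.odd_iff]; omega), mul_one,
      show (2 * l - 1 + 1) / 2 = l by omega]
  rw [multiTermTwo, chainTerm]
  simp only [weightTwo, Finset.prod_mul_distrib] at h ⊢
  rw [h, prod_Icc_ite_pow _ hi, Finset.prod_pow_eq_pow_sum, Finset.prod_pow_eq_pow_sum]
  ring

theorem GeomBounded.ite_const {f g : ℕ → ℂ} (c : Prop) [Decidable c] (hf : GeomBounded f)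
    (hg : GeomBounded g) : GeomBounded fun n => if c then f n else g n := by
  by_cases h : c <;> simpa [h]

theorem GeomBounded.const (c : ℂ) : GeomBounded fun _ => c := .of_bounded fun _ => le_rfl

theorem summable_weightOne (i : ℕ) {p : ℂ} (hp : ‖p‖ < 1) (a : ℂ) (j : ℕ) :
    Summable fun n => ‖weightOne i p a j n‖ := by
  have hq := norm_sq_lt_one hp
  have h1 : GeomBounded fun n => a ^ n * (if i ≤ j then (p ^ 2) ^ n else 1) :=
    (GeomBounded.pow a).mul ((GeomBounded.pow _).ite_const _ (.const 1))
  by_cases hj : j = 1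
  · refine ((h1.mul (geomBounded_qPoch (-p) hq)).summable_norm_pow_sq_mul hp).congr fun n => ?_
    rw [weightOne, if_pos hj]
    congr 1; ring
  · refine (h1.summable_norm_pow_sq_mul hq).congr fun n => ?_
    rw [weightOne, if_neg hj]
    congr 1; ring

theorem summable_weightTwo (i : ℕ) {p : ℂ} (hp : ‖p‖ < 1) (a : ℂ) (j : ℕ) :
    Summable fun n => ‖weightTwo i p a j n‖ :=
  GeomBounded.summable_norm_pow_sq_mul (((GeomBounded.pow a).mul
    ((GeomBounded.pow _).ite_const _ (.const 1))).ite_const _ (.const 1)) hp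

theorem summable_multiTermOne (k : ℕ) {i : ℕ} (hi : 1 ≤ i) {p : ℂ} (hp : ‖p‖ < 1) (a : ℂ) :
    Summable (multiTermOne k i p a) :=
  (summable_chainTerm (norm_sq_lt_one hp) (summable_weightOne i hp a)).congr fun s =>
    (multiTermOne_eq_chainTerm k hi p a s).symm

theorem summable_multiTermTwo (k : ℕ) {i : ℕ} (hi : 1 ≤ i) {p : ℂ} (hp : ‖p‖ < 1) (a : ℂ) :
    Summable (multiTermTwo k i p a) :=
  (summable_chainTerm (norm_sq_lt_one hp) (summable_weightTwo i hp a)).congr fun s =>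
    (multiTermTwo_eq_chainTerm k hi p a s).symm

theorem tsum_multiTermOne_one (p a : ℂ) : ∑' s, multiTermOne 1 1 p a s = 1 := by
  rw [tsum_congr (multiTermOne_eq_chainTerm 1 le_rfl p a)]
  refine (tsum_fintype (fun s : Fin 0 → ℕ => chainTerm (p ^ 2) (weightOne 1 p a) s)).trans ?_
  simp [chainTerm, chainWeight]

theorem tsum_multiTermTwo_one (p a : ℂ) : ∑' s, multiTermTwo 1 1 p a s = 1 := by
  rw [tsum_congr (multiTermTwo_eq_chainTerm 1 le_rfl p a)]
  refine (tsum_fintype (fun s : Fin 0 → ℕ => chainTerm (p ^ 2) (weightTwo 1 p a) s)).trans ?_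
  simp [chainTerm, chainWeight]

theorem tsum_multiTermOne (m : ℕ) {i : ℕ} (hi : 1 ≤ i) {p : ℂ} (hp : ‖p‖ < 1) (a : ℂ) :
    ∑' s, multiTermOne (m + 2) i p a s =
      ∑' N, a ^ N * (qPoch (-p) (p ^ 2) N * p ^ N ^ 2) * (if i ≤ 1 then (p ^ 2) ^ N else 1) *
        nestedSum (p ^ 2) (latticeWeight a (p ^ 2) (i - 1)) m N := by
  rw [tsum_congr (multiTermOne_eq_chainTerm (m + 2) hi p a)]
  refine (tsum_chainTerm (norm_sq_lt_one hp) (summable_weightOne i hp a) m).trans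
    (tsum_congr fun N => ?_)
  rw [nestedSum_congr (p ^ 2) (w' := latticeWeight a (p ^ 2) (i - 1)) fun j hj => ?_]
  · simp only [weightOne, if_true]
  · funext s
    simp only [weightOne, if_neg (show j + 1 ≠ 1 by omega), latticeWeight, tsub_le_iff_right]
    ring

theorem tsum_multiTermTwo (m : ℕ) {i : ℕ} (hi : 1 ≤ i) {p : ℂ} (hp : ‖p‖ < 1) (a : ℂ) :
    ∑' s, multiTermTwo (m + 2) i p a s =
      ∑' N, a ^ N * (qPoch (-p) (p ^ 2) N * p ^ N ^ 2) * (if i ≤ 1 then (p ^ 2) ^ N else 1) *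
        nestedSum (p ^ 2) (latticeWeight a (p ^ 2) (i - 1)) m N := by
  rw [tsum_congr (multiTermTwo_eq_chainTerm (m + 2) hi p a)]
  refine (tsum_chainTerm (norm_sq_lt_one hp) (summable_weightTwo i hp a) (2 * m + 1)).trans
    (tsum_congr fun N => ?_)
  have h1 : (fun j => weightTwo i p a (j + 1)) =
      interlacedWeight p fun l s => a ^ s * if i - 1 ≤ l then (p ^ 2) ^ s else 1 := by
    funext j s
    simp only [weightTwo, interlacedWeight, Nat.odd_add_one, Nat.not_odd_iff_even,
      tsub_le_iff_right, show (j + 1 + 1) / 2 = j / 2 + 1 by omega]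
  rw [h1, nestedSum_interlacedWeight hp]
  have h2 : weightTwo i p a 1 N = p ^ N ^ 2 * (a ^ N * if i ≤ 1 then (p ^ 2) ^ N else 1) := by
    simp [weightTwo]
  rw [h2]
  unfold latticeWeight
  ring

/-! ### The single sum as the `α` side of the Bailey chain. -/

theorem GeomBounded.unitU {a q : ℂ} (hq : ‖q‖ < 1) : GeomBounded (unitU a q) :=
  (((GeomBounded.pow (-1)).mul (.pow_of_norm_le_one hq.le _)).mul (geomBounded_qPoch _ hq)).mul
    (geomBounded_inv_qPoch hq (mul_pow_ne_one_of_norm_lt_one hq))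

theorem GeomBounded.bailey_factor {A q : ℂ} (hq : ‖q‖ < 1) (m : ℕ) :
    GeomBounded fun r => (A ^ r * q ^ r ^ 2) ^ m :=
  ((GeomBounded.pow A).mul (.pow_of_norm_le_one hq.le _)).pow_const m

theorem qPoch_mul_inv_qPochInf {a p : ℂ} (hp : ‖p‖ < 1)
    (ha : ∀ j : ℕ, a * p ^ 2 * (p ^ 2) ^ j ≠ 1) (n : ℕ) :
    qPoch (a * p ^ 2) (p ^ 2) n * (qPochInf (a * p ^ 2) (p ^ 2))⁻¹ =
      (qPochInf (a * (p ^ 2) ^ (n + 1)) (p ^ 2))⁻¹ := by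
  have h := qPoch_mul_qPochInf (a * p ^ 2) (norm_sq_lt_one hp) n
  rw [← h, show a * (p ^ 2) ^ (n + 1) = a * p ^ 2 * (p ^ 2) ^ n by ring, mul_inv,
    mul_inv_cancel_left₀ (qPoch_ne_zero ha n)]

theorem pow_sq_mul_pow_choose_two (p : ℂ) (n : ℕ) :
    p ^ n ^ 2 * (p ^ 2) ^ n.choose 2 * p ^ n = (p ^ 2) ^ n ^ 2 := by
  rw [← pow_mul, ← pow_mul, ← pow_add, ← pow_add]
  congr 1
  linarith [choose_two_add_choose_two_add_self n]

/-- For `i = 1` the bracket collapses to `1 - a q^{2n+1}`, the factor already present in the unit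
pair relative to `a q`; no change of parameter is needed. -/
theorem singleTerm_one_eq {a p : ℂ} (hp : ‖p‖ < 1)
    (ha : ∀ j : ℕ, a * p ^ 2 * (p ^ 2) ^ j ≠ 1) (d n : ℕ) :
    singleTerm (d + 1) 1 p a n = baileyWeight (a * p ^ 2) p n *
      (((a * p ^ 2) ^ n * (p ^ 2) ^ n ^ 2) ^ d *
        (unitU a (p ^ 2) n * (1 - a * (p ^ 2) ^ (2 * n + 1)) / (1 - a * p ^ 2))) := by
  have h1 := qPoch_mul_inv_qPochInf hp ha n
  have h2 := qPoch_mul_qPochInf (a * p ^ 2) (norm_sq_lt_one hp) 1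
  have h3 : qPoch (a * p ^ 2) (p ^ 2) 1 = 1 - a * p ^ 2 := by simp [qPoch]
  rw [h3, pow_one] at h2
  rw [← h2, mul_inv] at h1
  have h4 := pow_sq_mul_pow_choose_two p n
  rw [singleTerm, baileyWeight, unitU, Nat.add_sub_cancel, div_eq_mul_inv _ (_ * qPochInf _ _),
    mul_inv, ← h1, show a * p ^ 2 * p ^ (2 * n + 1) = a * p ^ (2 * n + 3) by ring]
  simp only [div_eq_mul_inv]
  generalize (qPochInf (a * p ^ 2 * p ^ 2) (p ^ 2))⁻¹ = y1
  generalize qPochInf (-(a * p ^ (2 * n + 3))) (p ^ 2) = y2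
  generalize (1 - a * p ^ 2)⁻¹ = y3
  generalize qPoch (a * p ^ 2) (p ^ 2) n = y4
  generalize (qPoch (p ^ 2) (p ^ 2) n)⁻¹ = y5
  generalize qPoch (-p) (p ^ 2) n = y6
  symm
  calc _ = (p ^ n ^ 2 * (p ^ 2) ^ n.choose 2 * p ^ n) * ((-1) ^ n * a ^ ((d + 1) * n) *
        (p ^ 2) ^ (d * n ^ 2) * p ^ ((2 * d + 1) * n) * (y6 * y2 * (y5 * (y4 * (y3 * y1)))) *
        (1 - a * p ^ (4 * n + 2))) := by ring
    _ = _ := by rw [h4]; ring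

/-- The bracket comes from two neighbouring weights: `1 + a p^{2n+1}` splits off the infinite
product in the weight at `n`, and `1 + p^{2n+1}` is the last factor of `(-p; q)_{n+1}` in the weight
at `n + 1`. -/
theorem singleTerm_add_two_eq {a p : ℂ} (hp : ‖p‖ < 1)
    (ha : ∀ j : ℕ, a * p ^ 2 * (p ^ 2) ^ j ≠ 1) (l d n : ℕ) :
    singleTerm (l + d + 2) (l + 2) p a n =
      baileyWeight a p n * (a ^ n * (p ^ 2) ^ n ^ 2) ^ l *
        (((a * p ^ 2) ^ n * (p ^ 2) ^ n ^ 2) ^ (d + 1) * unitU a (p ^ 2) n) -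
      baileyWeight a p (n + 1) * (a ^ (n + 1) * (p ^ 2) ^ (n + 1) ^ 2) ^ l *
        (a * (p ^ 2) ^ (2 * n + 1) *
          (((a * p ^ 2) ^ n * (p ^ 2) ^ n ^ 2) ^ (d + 1) * unitU a (p ^ 2) n)) := by
  have h1 := qPoch_mul_inv_qPochInf hp ha n
  have h2 := qPoch_mul_qPochInf (-(a * p ^ (2 * n + 1))) (norm_sq_lt_one hp) 1
  have h3 : qPoch (-(a * p ^ (2 * n + 1))) (p ^ 2) 1 = 1 + a * p ^ (2 * n + 1) := by simp [qPoch]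
  rw [h3, pow_one, show -(a * p ^ (2 * n + 1)) * p ^ 2 = -(a * p ^ (2 * n + 3)) by ring] at h2
  have h4 := pow_sq_mul_pow_choose_two p n
  rw [singleTerm, baileyWeight, baileyWeight, unitU, div_eq_mul_inv _ (_ * qPochInf _ _),
    mul_inv, ← h1, show 2 * (n + 1) + 1 = 2 * n + 3 by ring, ← h2, qPoch_succ,
    show l + d + 2 - (l + 2) = d by omega, show 2 * (l + 2) - 1 = 2 * l + 3 by omega]
  generalize (qPochInf (a * p ^ 2) (p ^ 2))⁻¹ = y1
  generalize qPochInf (-(a * p ^ (2 * n + 3))) (p ^ 2) = y2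
  generalize qPoch (a * p ^ 2) (p ^ 2) n = y4
  generalize (qPoch (p ^ 2) (p ^ 2) n)⁻¹ = y5
  generalize qPoch (-p) (p ^ 2) n = y6
  symm
  calc _ = (p ^ n ^ 2 * (p ^ 2) ^ n.choose 2 * p ^ n) * ((-1) ^ n * a ^ ((l + d + 2) * n) *
        (p ^ 2) ^ ((l + d + 1) * n ^ 2) * p ^ ((2 * d + 1) * n) * (y6 * y2 * (y5 * (y4 * y1))) *
        (1 + a * p ^ (2 * n + 1) -
          (1 + p ^ (2 * n + 1)) * a ^ (l + 2) * p ^ ((2 * l + 3) * (2 * n + 1)))) := by ring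
    _ = _ := by rw [h4]; ring

/-- Summation by parts. -/
theorem tsum_mul_sub_shift {X u c : ℕ → ℂ} (h1 : Summable fun r => X r * u r)
    (h2 : Summable fun r => X r * if r = 0 then 0 else c (r - 1)) :
    Summable (fun r => X r * u r - X (r + 1) * c r) ∧
      ∑' r, X r * (u r - if r = 0 then 0 else c (r - 1)) =
        ∑' r, (X r * u r - X (r + 1) * c r) := by
  have h3 : Summable fun r => X (r + 1) * c r := by
    simpa using (summable_nat_add_iff 1).2 h2
  refine ⟨h1.sub h3, ?_⟩
  simp only [mul_sub]
  rw [h1.tsum_sub h2, h1.tsum_sub h3, h2.tsum_eq_zero_add]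
  simp

theorem singleTerm_one_summable_and_tsum {a p : ℂ} (hp : ‖p‖ < 1)
    (ha : ∀ j : ℕ, a * p ^ 2 * (p ^ 2) ^ j ≠ 1) (d : ℕ) :
    Summable (singleTerm (d + 1) 1 p a) ∧
      ∑' n, singleTerm (d + 1) 1 p a n =
        ∑' N, (a * p ^ 2) ^ N * qPoch (-p) (p ^ 2) N * p ^ N ^ 2 *
          (baileyStep (a * p ^ 2) (p ^ 2))^[d] unitBeta N := by
  have hq := norm_sq_lt_one hp
  have ha' : ∀ j : ℕ, a * p ^ 2 * p ^ 2 * (p ^ 2) ^ j ≠ 1 := fun j => by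
    have := ha (j + 1)
    rwa [pow_succ' (p ^ 2) j, ← mul_assoc] at this
  have hpair := (isBaileyPair_unit hq ha).iterate hq ha' d
  have hα : GeomBounded fun r => ((a * p ^ 2) ^ r * (p ^ 2) ^ r ^ 2) ^ d *
      (unitU a (p ^ 2) r * (1 - a * (p ^ 2) ^ (2 * r + 1)) / (1 - a * p ^ 2)) :=
    (GeomBounded.bailey_factor hq d).mul (((GeomBounded.unitU hq).mul
      ((GeomBounded.const 1).sub ((GeomBounded.const a).mul (.pow_of_norm_le_one hq.le _)))).mul
        (.const _))
  refine ⟨(summable_baileyWeight_mul hp hα).congr fun n => (singleTerm_one_eq hp ha d n).symm, ?_⟩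
  rw [hpair.tsum_eq hp ha' hα]
  exact tsum_congr (singleTerm_one_eq hp ha d)

theorem singleTerm_add_two_summable_and_tsum {a p : ℂ} (hp : ‖p‖ < 1)
    (ha : ∀ j : ℕ, a * p ^ 2 * (p ^ 2) ^ j ≠ 1) (l d : ℕ) :
    Summable (singleTerm (l + d + 2) (l + 2) p a) ∧
      ∑' n, singleTerm (l + d + 2) (l + 2) p a n =
        ∑' N, a ^ N * qPoch (-p) (p ^ 2) N * p ^ N ^ 2 *
          (baileyStep a (p ^ 2))^[l] ((baileyStep (a * p ^ 2) (p ^ 2))^[d + 1] unitBeta) N := by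
  have hq := norm_sq_lt_one hp
  have ha' : ∀ j : ℕ, a * p ^ 2 * p ^ 2 * (p ^ 2) ^ j ≠ 1 := fun j => by
    have := ha (j + 1)
    rwa [pow_succ' (p ^ 2) j, ← mul_assoc] at this
  set u : ℕ → ℂ := fun r =>
    ((a * p ^ 2) ^ r * (p ^ 2) ^ r ^ 2) ^ (d + 1) * unitU a (p ^ 2) r with hu
  have hub : GeomBounded u := (GeomBounded.bailey_factor hq (d + 1)).mul (GeomBounded.unitU hq)
  have hcb : GeomBounded fun r => if r = 0 then 0 else a * (p ^ 2) ^ (2 * r - 1) * u (r - 1) :=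
    GeomBounded.of_comp_succ (by
      simpa using ((GeomBounded.const a).mul (.pow_of_norm_le_one hq.le _)).mul hub)
  have hpair : IsBaileyPair (a * p ^ 2) (p ^ 2)
      (fun r => u r * (1 - a * (p ^ 2) ^ (2 * r + 1)) / (1 - a * p ^ 2))
      ((baileyStep (a * p ^ 2) (p ^ 2))^[d + 1] unitBeta) := by
    convert (isBaileyPair_unit hq ha).iterate hq ha' (d + 1) using 2 with r
    simp only [hu]
    ring
  have hpair' := (hpair.of_mul_q hq ha).iterate hq ha l
  have hα := (GeomBounded.bailey_factor (A := a) hq l).mul (hub.sub hcb)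
  have hs := tsum_mul_sub_shift
    (X := fun r => baileyWeight a p r * (a ^ r * (p ^ 2) ^ r ^ 2) ^ l) (u := u)
    (c := fun r => a * (p ^ 2) ^ (2 * r + 1) * u r)
    ((summable_baileyWeight_mul hp ((GeomBounded.bailey_factor (A := a) hq l).mul hub)).congr
      fun r => (mul_assoc _ _ _).symm)
    ((summable_baileyWeight_mul hp ((GeomBounded.bailey_factor (A := a) hq l).mul hcb)).congr
      fun r => by
        rcases Nat.eq_zero_or_pos r with rfl | hr
        · simp
        · simp only [if_neg hr.ne', show 2 * (r - 1) + 1 = 2 * r - 1 by omega]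
          -- Both summability inputs concern whole sequences against `baileyWeight`; the case `r =
          -- 0` is separate because `2 * r - 1` truncates there.
          ring)
  refine ⟨hs.1.congr fun n => (singleTerm_add_two_eq hp ha l d n).symm, ?_⟩
  rw [hpair'.tsum_eq hp ha hα, tsum_congr (singleTerm_add_two_eq hp ha l d)]
  refine Eq.trans hs.2.symm (tsum_congr fun r => ?_)
  rw [mul_assoc]
  rcases Nat.eq_zero_or_pos r with rfl | hr
  · simp
  · simp only [if_neg hr.ne', show 2 * (r - 1) + 1 = 2 * r - 1 by omega]

theorem summable_and_tsum_singleTerm {k i : ℕ} (hi : 1 ≤ i) (hik : i ≤ k) {p a : ℂ}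
    (hp : ‖p‖ < 1) (ha : ∀ j : ℕ, a * p ^ 2 * (p ^ 2) ^ j ≠ 1) :
    Summable (singleTerm k i p a) ∧
      ∑' n, singleTerm k i p a n = ∑' s, multiTermOne k i p a s ∧
      ∑' s, multiTermOne k i p a s = ∑' s, multiTermTwo k i p a s := by
  rcases Nat.lt_or_ge k 2 with hk | hk
  · obtain rfl : i = 1 := by omega
    obtain rfl : k = 1 := by omega
    obtain ⟨h1, h2⟩ := singleTerm_one_summable_and_tsum hp ha 0
    refine ⟨h1, ?_, by rw [tsum_multiTermOne_one, tsum_multiTermTwo_one]⟩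
    rw [tsum_multiTermOne_one, h2, tsum_eq_single 0]
    · simp [unitBeta, qPoch_zero]
    · intro N hN; simp [unitBeta, hN]
  · obtain ⟨m, rfl⟩ := Nat.exists_eq_add_of_le' hk
    rcases Nat.lt_or_ge i 2 with hi2 | hi2
    · obtain rfl : i = 1 := by omega
      obtain ⟨h1, h2⟩ := singleTerm_one_summable_and_tsum hp ha (m + 1)
      refine ⟨h1, ?_, by rw [tsum_multiTermOne m hi hp, tsum_multiTermTwo m hi hp]⟩
      rw [h2, tsum_multiTermOne m hi hp]
      refine tsum_congr fun N => ?_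
      rw [nestedSum_latticeWeight_of_le_one _ _ (by omega), if_pos le_rfl]
      ring
    · obtain ⟨l, rfl⟩ := Nat.exists_eq_add_of_le' hi2
      obtain ⟨d, rfl⟩ := Nat.exists_eq_add_of_le (show l ≤ m by omega)
      obtain ⟨h1, h2⟩ := singleTerm_add_two_summable_and_tsum hp ha l d
      refine ⟨h1, ?_, by rw [tsum_multiTermOne _ hi hp, tsum_multiTermTwo _ hi hp]⟩
      rw [h2, tsum_multiTermOne _ hi hp]
      refine tsum_congr fun N => ?_
      rw [show l + 2 - 1 = l + 1 by omega, nestedSum_latticeWeight _ _ (Nat.le_add_right l d),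
        if_neg (by omega), Nat.add_sub_cancel_left]
      ring

/-! ### The specialization `a = 1` and the theta series. -/

theorem thetaTerm_eq {k i : ℕ} (hi : 1 ≤ i) (hik : i ≤ k) (p : ℂ) (n : ℕ) :
    thetaTerm k i p n = (p ^ (4 * k)) ^ (n + 1).choose 2 *
      ((-p ^ (2 * i - 1)) ^ (n + 1) + (-p ^ (4 * k - 2 * i + 1)) ^ (n + 1)) := by
  obtain ⟨i, rfl⟩ := Nat.exists_eq_add_of_le' hi
  obtain ⟨d, rfl⟩ := Nat.exists_eq_add_of_le hik
  have hc := choose_two_add_choose_two_add_self (n + 1)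
  rw [thetaTerm, Nat.add_sub_cancel_left, ← hc]
  rw [show 2 * (i + 1) - 1 = 2 * i + 1 by omega,
    show 4 * (i + 1 + d) - 2 * (i + 1) + 1 = 2 * i + 4 * d + 3 by omega]
  generalize (n + 1).choose 2 = c
  rw [show 2 * (i + 1 + d) * (c + c + (n + 1)) - (2 * d + 1) * (n + 1) =
      4 * (i + 1 + d) * c + (2 * i + 1) * (n + 1) from Nat.sub_eq_of_eq_add (by ring)]
  rw [neg_pow (p ^ _), neg_pow (p ^ _)]
  ring

theorem summable_thetaTerm {k i : ℕ} (hi : 1 ≤ i) (hik : i ≤ k) {p : ℂ} (hp : ‖p‖ < 1) :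
    Summable (thetaTerm k i p) := by
  have hQ : ‖p ^ (4 * k)‖ < 1 := by
    rw [norm_pow]; exact pow_lt_one₀ (norm_nonneg p) hp (by omega)
  exact (summable_theta hQ _ _).of_norm.congr fun n => (thetaTerm_eq hi hik p n).symm

theorem one_add_tsum_thetaTerm {k i : ℕ} (hi : 1 ≤ i) (hik : i ≤ k) {p : ℂ} (hp : ‖p‖ < 1) :
    1 + ∑' n, thetaTerm k i p n = qPochInf (p ^ (4 * k)) (p ^ (4 * k)) *
      (qPochInf (p ^ (2 * i - 1)) (p ^ (4 * k)) *
        qPochInf (p ^ (4 * k - 2 * i + 1)) (p ^ (4 * k))) := by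
  rw [tsum_congr (thetaTerm_eq hi hik p)]
  -- The triple product was proved by dividing by powers of its base; at `p = 0` both sides equal
  -- `1`.
  by_cases hp0 : p = 0
  · subst hp0
    simp [show k ≠ 0 by omega, show 2 * i - 1 ≠ 0 by omega, qPochInf_zero_left]
  · refine jacobi_triple_product ?_ (pow_ne_zero _ hp0) ?_
    · rw [norm_pow]; exact pow_lt_one₀ (norm_nonneg p) hp (by omega)
    · rw [← pow_add]; congr 1; omega

theorem tsum_singleTerm_one {k i : ℕ} (hi : 1 ≤ i) (hik : i ≤ k) {p : ℂ} (hp : ‖p‖ < 1) :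
    ∑' n, singleTerm k i p 1 n =
      qPochInf (-p) (p ^ 2) / qPochInf (p ^ 2) (p ^ 2) * (1 + ∑' n, thetaTerm k i p n) := by
  have hq := norm_sq_lt_one hp
  set A : ℕ → ℂ := fun n => (-1) ^ n * (p ^ 2) ^ (k * n ^ 2) * p ^ ((2 * (k - i) + 1) * n) with hA
  set B : ℕ → ℂ := fun n => A n * p ^ ((2 * i - 1) * (2 * n + 1)) with hB
  have hterm : ∀ n, singleTerm k i p 1 n =
      qPochInf (-p) (p ^ 2) / qPochInf (p ^ 2) (p ^ 2) * (A n - B n) := by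
    intro n
    -- At `a = 1` the bracket has the factor `1 + p^{2n+1}`, exactly the one missing between `(-p;
    -- q)_n` and `(-p^{2n+3}; q)_∞`.
    have h1 := qPoch_mul_qPochInf (-p) hq (n + 1)
    have h2 := qPoch_mul_qPochInf (p ^ 2) hq n
    rw [qPoch_succ, show -p * (p ^ 2) ^ (n + 1) = -p ^ (2 * n + 3) by ring,
      show -p * (p ^ 2) ^ n = -p ^ (2 * n + 1) by ring, sub_neg_eq_add] at h1
    rw [← pow_succ'] at h2
    rw [singleTerm, ← h1, ← h2]
    simp only [one_pow, one_mul, mul_one, hA, hB]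
    ring
  have hAs : Summable A := by
    have : ‖(p ^ 2) ^ k‖ < 1 := by
      rw [norm_pow]; exact pow_lt_one₀ (norm_nonneg _) hq (by omega)
    refine ((GeomBounded.pow (-1)).mul
      (GeomBounded.pow (p ^ (2 * (k - i) + 1)))).summable_norm_pow_sq_mul this |>.of_norm.congr
        fun n => ?_
    simp only [hA]; ring
  -- Pairing `B n` with `A (n + 1)` instead of `A n` gives the theta term of index `n + 1` and
  -- leaves `A 0 = 1` over.
  have htheta : ∀ n, thetaTerm k i p n = A (n + 1) - B n := by
    intro n
    obtain ⟨i, rfl⟩ := Nat.exists_eq_add_of_le' hi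
    obtain ⟨d, rfl⟩ := Nat.exists_eq_add_of_le hik
    simp only [thetaTerm, hA, hB, Nat.add_sub_cancel_left]
    rw [show 2 * (i + 1) - 1 = 2 * i + 1 by omega,
      show 2 * (i + 1 + d) * (n + 1) ^ 2 - (2 * d + 1) * (n + 1) =
        2 * (i + 1 + d) * n ^ 2 + (2 * d + 1) * n + (2 * i + 1) * (2 * n + 1) from
      Nat.sub_eq_of_eq_add (by ring)]
    ring
  have hAs' : Summable fun n => A (n + 1) := (summable_nat_add_iff 1).2 hAs
  have hBs : Summable B := by
    refine (hAs'.sub (summable_thetaTerm hi hik hp)).congr fun n => ?_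
    rw [htheta]; ring
  rw [tsum_congr hterm, tsum_mul_left, hAs.tsum_sub hBs, tsum_congr htheta, hAs'.tsum_sub hBs,
    hAs.tsum_eq_zero_add]
  have : A 0 = 1 := by simp [hA]
  rw [this, add_sub_assoc]

theorem theorem5p1 (k i : ℕ) (hi : 1 ≤ i) (hik : i ≤ k) (r : ℂ) (hr : ‖r‖ < 1) :
    (∀ a : ℂ, (∀ n : ℕ, 1 ≤ n → a * (r ^ 2) ^ n ≠ 1) →
      Summable (singleTerm k i r a) ∧
      Summable (multiTermOne k i r a) ∧
      Summable (multiTermTwo k i r a) ∧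
      ∑' n, singleTerm k i r a n = ∑' s, multiTermOne k i r a s ∧
      ∑' s, multiTermOne k i r a s = ∑' s, multiTermTwo k i r a s) ∧
    (Summable (thetaTerm k i r) ∧
      ∑' s, multiTermTwo k i r 1 s =
        qPochInf (-r) (r ^ 2) / qPochInf (r ^ 2) (r ^ 2) * (1 + ∑' n, thetaTerm k i r n) ∧
      qPochInf (-r) (r ^ 2) / qPochInf (r ^ 2) (r ^ 2) * (1 + ∑' n, thetaTerm k i r n) =
        qPochInf (-r) (r ^ 2)
          * (qPochInf (r ^ (4 * k)) (r ^ (4 * k)) * qPochInf (r ^ (2 * i - 1)) (r ^ (4 * k))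
              * qPochInf (r ^ (4 * k - 2 * i + 1)) (r ^ (4 * k)))
          / qPochInf (r ^ 2) (r ^ 2)) := by

  refine ⟨fun a ha => ?_, summable_thetaTerm hi hik hr, ?_, ?_⟩
  · have ha' : ∀ j : ℕ, a * r ^ 2 * (r ^ 2) ^ j ≠ 1 := fun j => by
      rw [mul_assoc, ← pow_succ']; exact ha (j + 1) (by omega)
    obtain ⟨h1, h2⟩ := summable_and_tsum_singleTerm hi hik hr ha'
    exact ⟨h1, summable_multiTermOne k hi hr a, summable_multiTermTwo k hi hr a, h2⟩
  · have h1 : ∀ j : ℕ, 1 * r ^ 2 * (r ^ 2) ^ j ≠ 1 := fun j => by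
      rw [one_mul]; exact mul_pow_ne_one_of_norm_lt_one (norm_sq_lt_one hr) j
    obtain ⟨-, h2, h3⟩ := summable_and_tsum_singleTerm hi hik hr h1
    rw [← h3, ← h2, tsum_singleTerm_one hi hik hr]
  · rw [one_add_tsum_thetaTerm hi hik hr]
    ring
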